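/- **Proposition (Consistency and asymptotic Normality in short panels).** Consider a sequence of panels (the index $n$ is suppressed; all objects may change along it) with $I$ units and $T$ periods $t=1,\dots,T$, a non-stochastic set $\Omega$ of observations $it$ (not necessarily complete), and non-stochastic event dates $E_i$ ($E_i=\infty$ if $i$ is not treated in any of the periods), so that $D_{it}=\mathbf 1[t\ge E_i]$. Let $\Omega_1=\{it\in\Omega: D_{it}=1\}$, $\Omega_0=\{it\in\Omega: D_{it}=0\}$. Let $Y_{it}$ be the outcomes, $Y_{it}(0)$ the potential outcomes without treatment, $\varepsilon_{it}=Y_{it}-E[Y_{it}]$, and assume: * (parallel trends) $E[Y_{it}(0)]=\alpha_i+\beta_t$ for all $it\in\Omega$, with non-stochastic $\alpha_i,\beta_t$; * (no anticipation) $Y_{it}=Y_{it}(0)$ for all $it\in\Omega_0$; * (clustered errors) $\operatorname{Cov}(\varepsilon_{it},\varepsilon_{js})=0$ for $i\ne j$, and $\operatorname{Var}(\varepsilon_{it})\le\bar\sigma^2$ uniformly. The effects $\tau_{it}=E[Y_{it}-Y_{it}(0)]$, $it\in\Omega_1$, are unrestricted. For non-stochastic weights $w_1=(w_{it})_{it\in\Omega_1}$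 the target is $\tau_w=\sum_{it\in\Omega_1}w_{it}\tau_{it}$, assumed identified: every $(a_i),(b_t)$ with $a_i+b_t=0$ on $\Omega_0$ satisfies $\sum_{it\in\Omega_1}w_{it}(a_i+b_t)=0$. The estimator is $\hat\tau_w^*=\sum_{it\in\Omega_1}w_{it}\hat\tau_{it}$, where $\hat\tau_{it}$ are the coefficients from ordinary least squares in $Y_{it}=\alpha_i+\beta_t+D_{it}\tau_{it}+\varepsilon_{it}$ on $\Omega$. It is linear, $\hat\tau_w^*=\sum_{it\in\Omega}v_{it}^*Y_{it}$; write $\sigma_w^2=\operatorname{Var}(\hat\tau_w^*)$ and $n_H=\big(\sum_i(\sum_t|v_{it}^*|)^2\big)^{-1}$. **(i) Consistency.** Suppose that every unit is observed and untreated in the first period and that, along the sequence (with $0/0=0$), 1. $\sum_{i}\big(\sum_{t;D_{it}=1}|w_{it}|\big)^2\to0$; 2. $T\sum_{i}\big(\sum_{t;D_{it}=1}w_{it}\big)^2\to0$; 3. $T^2\sum_{t=2}^T\dfrac{(\sum_{i;D_{it}=1}w_{it})^2}{\sum_{i;D_{it}=0}1}\to0$, with all sums over observations in $\Omega$. Then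 $\hat\tau^*_w-\tau_w\to0$ in $L^2$, and hence in probability. **(ii)** Suppose in addition that the panel is complete, that $T$ is fixed, that $E[\varepsilon_{it}^4]$ is uniformly bounded, that there is a constant $C$ such that for all $t$ and $i,j$ with $E_i=E_j$, $D_{it}=D_{jt}=1$ and $w_{it}\ne0$ we have $w_{jt}\ne0$ and $|w_{it}|/|w_{jt}|\le C$, and that cohort sizes grow: for every $M$, eventually each cohort (set of units with a common event date, including the never-treated units) is empty or has at least $M$ members. * *($\sqrt I$-consistency)* If moreover cohorts grow proportionally to $I$ (there is $c>0$ such that eventually every non-empty cohort has at least $cI$ members) and the total absolute weight $\sum_{it\in\Omega_1}|w_{it}|$ is bounded, then $\sqrt I\,(\hat\tau_w^*-\tau_w)=O_p(1)$. * *(asymptotic Normality)* If moreover the error vectors $(\varepsilon_{it})_t$ are independent across units $i$ and $\liminf n_H\sigma_w^2>0$, then $\sigma_w^{-1}(\hat\tau_w^*-\tau_w)\xrightarrow{d}\mathcal N(0,1)$. -/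

import Mathlib

open MeasureTheory ProbabilityTheory Filter Topology

noncomputable section

/-- A staggered-rollout panel with `I` units and `T` periods (period `t : Fin T` is the `(t+1)`-st
period of the data). `obs` is the set `Ω` of observations, which need not be complete, and `E i`
is the event date of unit `i`, with `E i = ⊤` if unit `i` is not treated in any of the periods. -/
structure Panel where
  I : ℕ
  T : ℕ
  obs : Finset (Fin I × Fin T)
  E : Fin I → WithTop (Fin T)

namespace Panel

/-- `D_it = 1`: treatment is absorbing and starts at the event date. -/
def Treated (d : Panel) (i : Fin d.I) (t : Fin d.T) : Prop :=
  d.E i ≤ (t : WithTop (Fin d.T))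

open Classical in
/-- The treated observations `Ω₁`. -/
def treatedObs (d : Panel) : Finset (Fin d.I × Fin d.T) :=
  d.obs.filter fun p => d.Treated p.1 p.2

open Classical in
/-- The untreated (never-treated and not-yet-treated) observations `Ω₀`. -/
def untreatedObs (d : Panel) : Finset (Fin d.I × Fin d.T) :=
  d.obs.filter fun p => ¬ d.Treated p.1 p.2

/-- The number of untreated observations in period `t`. -/
def numUntreated (d : Panel) (t : Fin d.T) : ℕ :=
  (d.untreatedObs.filter fun p => p.2 = t).card

open Classical in
/-- The number of units whose event date is `e`; for `e = ⊤`, those never treated in the data. -/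
def cohortSize (d : Panel) (e : WithTop (Fin d.T)) : ℕ :=
  (Finset.univ.filter fun i : Fin d.I => d.E i = e).card

/-! ### The ordinary least squares estimator -/

/-- Coefficients `(α, β, τ)` of the regression `Y_it = α_i + β_t + D_it τ_it + ε_it`, with unit and
period fixed effects and unrestricted treatment effects. -/
abbrev Coef (d : Panel) : Type :=
  (Fin d.I → ℝ) × (Fin d.T → ℝ) × (Fin d.I → Fin d.T → ℝ)

open Classical in
/-- The regression function `α_i + β_t + D_it τ_it`. -/
def fitted (d : Panel) (θ : d.Coef) (i : Fin d.I) (t : Fin d.T) : ℝ :=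
  θ.1 i + θ.2.1 t + if d.Treated i t then θ.2.2 i t else 0

/-- The sum of squared residuals over the sample. -/
def ssr (d : Panel) (y : Fin d.I → Fin d.T → ℝ) (θ : d.Coef) : ℝ :=
  ∑ p ∈ d.obs, (y p.1 p.2 - d.fitted θ p.1 p.2) ^ 2

/-- `θ` is an ordinary least squares fit to the outcomes `y`. -/
def IsOLS (d : Panel) (y : Fin d.I → Fin d.T → ℝ) (θ : d.Coef) : Prop :=
  ∀ θ' : d.Coef, d.ssr y θ ≤ d.ssr y θ'

theorem exists_isOLS (d : Panel) (y : Fin d.I → Fin d.T → ℝ) : ∃ θ : d.Coef, d.IsOLS y θ := by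
  classical
  let L : d.Coef →ₗ[ℝ] EuclideanSpace ℝ d.obs :=
    { toFun := fun θ => WithLp.toLp 2 fun p => d.fitted θ p.1.1 p.1.2
      map_add' := by
        intro a b
        ext p
        simp only [fitted, Prod.fst_add, Prod.snd_add, Pi.add_apply, PiLp.add_apply]
        split_ifs <;> ring
      map_smul' := by
        intro c a
        ext p
        simp only [fitted, Prod.smul_fst, Prod.smul_snd, Pi.smul_apply, PiLp.smul_apply,
          smul_eq_mul, RingHom.id_apply]
        split_ifs <;> ring }
  let z : EuclideanSpace ℝ d.obs := WithLp.toLp 2 fun p => y p.1.1 p.1.2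
  have hssr : ∀ θ, d.ssr y θ = dist z (L θ) ^ 2 := by
    intro θ
    rw [EuclideanSpace.dist_eq, Real.sq_sqrt (Finset.sum_nonneg fun _ _ => sq_nonneg _), ssr,
      ← Finset.sum_coe_sort]
    refine Finset.sum_congr rfl fun p _ => ?_
    rw [Real.dist_eq, sq_abs]
    rfl
  obtain ⟨x, hx, hd⟩ := (Submodule.closed_of_finiteDimensional
    (LinearMap.range L)).exists_infDist_eq_dist ⟨0, Submodule.zero_mem _⟩ z
  obtain ⟨θ, rfl⟩ := hx
  refine ⟨θ, fun θ' => ?_⟩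
  rw [hssr, hssr]
  refine pow_le_pow_left₀ dist_nonneg ?_ 2
  rw [← hd]
  exact Metric.infDist_le_dist_of_mem ⟨θ', rfl⟩

/-- The estimator: run the regression, and form the weighted sum `∑_{it ∈ Ω₁} w_it τ̂_it`. -/
def estimator (d : Panel) (w : Fin d.I → Fin d.T → ℝ) (y : Fin d.I → Fin d.T → ℝ) : ℝ :=
  ∑ p ∈ d.treatedObs, w p.1 p.2 * (d.exists_isOLS y).choose.2.2 p.1 p.2

/-- The implied weight `v*_it` of the (linear) estimator on the outcome of observation `it`. -/
def impliedWeight (d : Panel) (w : Fin d.I → Fin d.T → ℝ) (i : Fin d.I) (t : Fin d.T) : ℝ :=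
  d.estimator w (Pi.single i (Pi.single t 1))

open Classical in
/-- The clustered Herfindahl index `∑_i (∑_t |v*_it|)²` of the implied weights; its inverse is the
effective sample size. -/
def herfindahl (d : Panel) (w : Fin d.I → Fin d.T → ℝ) : ℝ :=
  ∑ i, (∑ t with (i, t) ∈ d.obs, |d.impliedWeight w i t|) ^ 2

/-- The estimand is identified by the two-way fixed-effects model for untreated outcomes: fixed
effects that vanish on all untreated observations contribute nothing to the imputed total. -/
def Identified (d : Panel) (w : Fin d.I → Fin d.T → ℝ) : Prop :=
  ∀ (α : Fin d.I → ℝ) (β : Fin d.T → ℝ), (∀ p ∈ d.untreatedObs, α p.1 + β p.2 = 0) →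
    ∑ p ∈ d.treatedObs, w p.1 p.2 * (α p.1 + β p.2) = 0

/-! ### The outcome model for one panel -/

section Model

variable {S : Type*} [MeasurableSpace S]

/-- Parallel trends: `E[Y_it(0)] = α_i + β_t` for all observations. -/
def ParallelTrends (d : Panel) (P : Measure S) (Y0 : Fin d.I → Fin d.T → S → ℝ) : Prop :=
  ∃ (α : Fin d.I → ℝ) (β : Fin d.T → ℝ), ∀ p ∈ d.obs,
    Integrable (Y0 p.1 p.2) P ∧ ∫ ω, Y0 p.1 p.2 ω ∂P = α p.1 + β p.2

/-- No anticipation effects: `Y_it = Y_it(0)` for all untreated observations. -/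
def NoAnticipation (d : Panel) (P : Measure S) (Y Y0 : Fin d.I → Fin d.T → S → ℝ) : Prop :=
  ∀ p ∈ d.untreatedObs, Y p.1 p.2 =ᵐ[P] Y0 p.1 p.2

/-- The error term `ε_it = Y_it - E[Y_it]`. -/
def err (d : Panel) (P : Measure S) (Y : Fin d.I → Fin d.T → S → ℝ)
    (i : Fin d.I) (t : Fin d.T) (ω : S) : ℝ :=
  Y i t ω - ∫ ω', Y i t ω' ∂P

/-- The target `τ_w = ∑_{it ∈ Ω₁} w_it τ_it` with `τ_it = E[Y_it - Y_it(0)]`. -/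
def target (d : Panel) (P : Measure S) (w : Fin d.I → Fin d.T → ℝ)
    (Y Y0 : Fin d.I → Fin d.T → S → ℝ) : ℝ :=
  ∑ p ∈ d.treatedObs, w p.1 p.2 * ∫ ω, (Y p.1 p.2 ω - Y0 p.1 p.2 ω) ∂P

/-- The estimator, as a random variable. -/
def tauHat (d : Panel) (w : Fin d.I → Fin d.T → ℝ) (Y : Fin d.I → Fin d.T → S → ℝ) (ω : S) : ℝ :=
  d.estimator w fun i t => Y i t ω

/-- Error terms that are uncorrelated across units, with finite variances of at most `σ2`. -/
def ClusteredErrors (d : Panel) (P : Measure S) (Y : Fin d.I → Fin d.T → S → ℝ) (σ2 : ℝ) : Prop :=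
  (∀ p ∈ d.obs, MemLp (Y p.1 p.2) 2 P ∧
    ProbabilityTheory.variance (d.err P Y p.1 p.2) P ≤ σ2) ∧
  ∀ p ∈ d.obs, ∀ q ∈ d.obs, p.1 ≠ q.1 →
    ProbabilityTheory.covariance (d.err P Y p.1 p.2) (d.err P Y q.1 q.2) P = 0

/-- The error vectors `(ε_it)_t` of the units are mutually independent. -/
def IndependentUnits (d : Panel) (P : Measure S) (Y : Fin d.I → Fin d.T → S → ℝ) : Prop :=
  iIndepFun (fun (i : Fin d.I) (ω : S) (t : Fin d.T) => d.err P Y i t ω) P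

end Model

end Panel

/-! ### Conditions along a sequence of panels -/

/-- Every unit is observed and untreated in the first period, and the three rate conditions on the
weights hold. -/
structure ConsistencyConditions (d : ℕ → Panel)
    (w : ∀ n, Fin (d n).I → Fin (d n).T → ℝ) : Prop where
  first_period : ∀ n i, ∃ t : Fin (d n).T, (t : ℕ) = 0 ∧ (i, t) ∈ (d n).untreatedObs
  weights_herfindahl : Tendsto (fun n => ∑ i : Fin (d n).I,
    (∑ p ∈ (d n).treatedObs with p.1 = i, |w n p.1 p.2|) ^ 2) atTop (𝓝 0)
  net_weights : Tendsto (fun n => ((d n).T : ℝ) * ∑ i : Fin (d n).I,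
    (∑ p ∈ (d n).treatedObs with p.1 = i, w n p.1 p.2) ^ 2) atTop (𝓝 0)
  period_weights : Tendsto (fun n => ((d n).T : ℝ) ^ 2 * ∑ t with 0 < Fin.val (n := (d n).T) t,
    (∑ p ∈ (d n).treatedObs with p.2 = t, w n p.1 p.2) ^ 2 / ((d n).numUntreated t : ℝ))
    atTop (𝓝 0)

/-- Complete panels with a fixed number of periods, bounded fourth moments of the errors, weights
that are comparable within cohort-period cells, and cohorts (the never-treated units included)
that grow in size unless they are empty. -/
structure NormalityConditions {S : ℕ → Type*} [∀ n, MeasurableSpace (S n)]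
    (P : ∀ n, Measure (S n)) (d : ℕ → Panel)
    (w : ∀ n, Fin (d n).I → Fin (d n).T → ℝ)
    (Y : ∀ n, Fin (d n).I → Fin (d n).T → S n → ℝ) : Prop where
  complete : ∀ n, (d n).obs = Finset.univ
  fixed_periods : ∃ T : ℕ, ∀ n, (d n).T = T
  fourth_moments : ∃ K : ℝ, ∀ n i t, MemLp ((d n).err (P n) (Y n) i t) 4 (P n) ∧
    ∫ ω, (d n).err (P n) (Y n) i t ω ^ 4 ∂(P n) ≤ K
  comparable_weights : ∃ C : ℝ, ∀ n i j t, (d n).E i = (d n).E j → (d n).Treated i t →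
    w n i t ≠ 0 → w n j t ≠ 0 ∧ |w n i t| / |w n j t| ≤ C
  growing_cohorts : ∀ M : ℕ, ∀ᶠ n in atTop, ∀ e : WithTop (Fin (d n).T),
    (d n).cohortSize e = 0 ∨ M ≤ (d n).cohortSize e

/-- Every non-empty cohort makes up at least a fixed positive share of the units, and the total
absolute weight is bounded. -/
structure RateConditions (d : ℕ → Panel) (w : ∀ n, Fin (d n).I → Fin (d n).T → ℝ) : Prop where
  cohort_shares : ∃ c : ℝ, 0 < c ∧ ∀ᶠ n in atTop, ∀ e : WithTop (Fin (d n).T),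
    (d n).cohortSize e = 0 ∨ c * ((d n).I : ℝ) ≤ ((d n).cohortSize e : ℝ)
  bounded_weights : ∃ B : ℝ, ∀ᶠ n in atTop, ∑ p ∈ (d n).treatedObs, |w n p.1 p.2| ≤ B

/-- `liminf n_H σ_w² > 0`, for the variance `σ_w²` of the estimator and the effective sample size
`n_H`, the inverse of the clustered Herfindahl index. -/
def NonvanishingVariance {S : ℕ → Type*} [∀ n, MeasurableSpace (S n)]
    (P : ∀ n, Measure (S n)) (d : ℕ → Panel)
    (w : ∀ n, Fin (d n).I → Fin (d n).T → ℝ)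
    (Y : ∀ n, Fin (d n).I → Fin (d n).T → S n → ℝ) : Prop :=
  ∃ c : ℝ, 0 < c ∧ ∀ᶠ n in atTop,
    c ≤ ((d n).herfindahl (w n))⁻¹ * ProbabilityTheory.variance ((d n).tauHat (w n) (Y n)) (P n)

end

/-!
# Consistency and asymptotic Normality of the imputation estimator

A treated observation has a regression coefficient of its own, so that least squares fits it
perfectly and the fixed effects are estimated from the untreated observations alone. By the normal
equations and identification, the estimator is linear; its implied weights equal `w` on treated
observations, are of the form `l i + m t` on untreated ones, and are balanced: they annihilate all
unit and period effects (`Panel.Balanced.impliedWeight`). Hence the estimation error is the weighted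
sum of the error terms (`Panel.tauHat_sub_target`), with mean zero, and its variance is at most `σ2`
times the clustered Herfindahl index of the implied weights (`Panel.estimation_error`).

*Consistency.* The implied weights have the smallest sum of squares among all balanced weights
(`Panel.Balanced.sum_impliedWeight_sq_le`). Comparing them with explicit difference-in-differences
weights that use the first period as the base (`didWeight`) bounds the Herfindahl index by the three
quantities in the rate conditions (`Panel.herfindahl_le`), which vanish in the limit. The same
difference-in-differences weights give linearity without any duality argument: the implied weights
are the least squares projection of these weights on the fixed effects.

*Root-`I` consistency.* Comparable weights and proportional cohorts make each treated weight of
order `1 / I`, and then the same bound makes the Herfindahl index of order `1 / I`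
(`Panel.units_mul_herfindahl_le`).

*Asymptotic Normality.* In a complete panel the untreated implied weights of two units of one cohort
differ by a constant over time, and the implied weights of each unit sum to zero. With comparable
treated weights it follows that the total absolute weights of the units of a cohort are comparable
(`Panel.sum_abs_impliedWeight_le_of_cohort`), so that in growing cohorts no unit dominates the
Herfindahl index (`tendsto_lyapunov_ratio`). As the variance is at least of the order of this index,
Lyapunov's condition holds with fourth moments, and the central limit theorem for triangular arrays
applies (`tendstoInDistribution_sum_of_fourth_moments`); it is proved with characteristic functions.
-/

/-! ### A central limit theorem for triangular arrays -/

theorem norm_cexp_mul_I_sub_le (x : ℝ) :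
    ‖Complex.exp (x * Complex.I) - (1 + x * Complex.I - x ^ 2 / 2)‖ ≤ 4 * |x| ^ 3 := by
  have hx : ‖(x : ℂ) * Complex.I‖ = |x| := by simp
  rcases le_or_gt |x| 1 with h | h
  · have h1 := Complex.exp_bound (x := (x : ℂ) * Complex.I) (by rwa [hx]) (n := 3) (by norm_num)
    rw [hx] at h1
    have h2 : ∑ m ∈ Finset.range 3, ((x : ℂ) * Complex.I) ^ m / (m.factorial : ℂ)
        = 1 + x * Complex.I - x ^ 2 / 2 := by
      simp [Finset.sum_range_succ, mul_pow, Nat.factorial]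
      ring
    rw [h2] at h1
    refine h1.trans ?_
    have : (0 : ℝ) ≤ |x| ^ 3 := by positivity
    norm_num [Nat.factorial]
    linarith
  · have h1 : ‖Complex.exp (x * Complex.I) - (1 + x * Complex.I - x ^ 2 / 2)‖
        ≤ 1 + (1 + |x| + |x| ^ 2 / 2) := by
      refine (norm_sub_le _ _).trans (add_le_add (by simp) ?_)
      refine (norm_sub_le _ _).trans (add_le_add ((norm_add_le _ _).trans (by simp)) ?_)
      simp
    refine h1.trans ?_
    have h2 : |x| ≤ |x| ^ 3 := le_self_pow₀ h.le (by norm_num)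
    have h3 : |x| ^ 2 ≤ |x| ^ 3 := pow_le_pow_right₀ h.le (by norm_num)
    linarith

theorem abs_exp_neg_sub_le {x : ℝ} (hx : 0 ≤ x) : |Real.exp (-x) - (1 - x)| ≤ x ^ 2 := by
  have h1 := Real.add_one_le_exp (-x)
  have h2 := Real.add_one_le_exp x
  have h3 : Real.exp (-x) * Real.exp x = 1 := by rw [← Real.exp_add]; simp
  rw [abs_of_nonneg (by linarith)]
  have h4 := Real.exp_pos (-x)
  -- `exp (-x) ≤ 1 / (1 + x) ≤ 1 - x + x ^ 2`
  nlinarith [mul_le_mul_of_nonneg_left h2 h4.le, pow_nonneg hx 3]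

theorem norm_prod_sub_prod_le {ι : Type*} (s : Finset ι) (a b : ι → ℂ)
    (ha : ∀ i ∈ s, ‖a i‖ ≤ 1) (hb : ∀ i ∈ s, ‖b i‖ ≤ 1) :
    ‖∏ i ∈ s, a i - ∏ i ∈ s, b i‖ ≤ ∑ i ∈ s, ‖a i - b i‖ := by
  classical
  induction s using Finset.induction_on with
  | empty => simp
  | insert j s hj ih =>
    rw [Finset.prod_insert hj, Finset.prod_insert hj, Finset.sum_insert hj]
    have h1 : ‖∏ i ∈ s, b i‖ ≤ 1 := by
      rw [norm_prod]
      exact Finset.prod_le_one (fun _ _ => norm_nonneg _)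
        fun i hi => hb i (Finset.mem_insert_of_mem hi)
    have h2 := ih (fun i hi => ha i (Finset.mem_insert_of_mem hi))
      fun i hi => hb i (Finset.mem_insert_of_mem hi)
    have h3 : a j * ∏ i ∈ s, a i - b j * ∏ i ∈ s, b i
        = (a j - b j) * ∏ i ∈ s, b i + a j * (∏ i ∈ s, a i - ∏ i ∈ s, b i) := by ring
    rw [h3]
    refine (norm_add_le _ _).trans (add_le_add ?_ ?_)
    · rw [norm_mul]
      exact mul_le_of_le_one_right (norm_nonneg _) h1
    · rw [norm_mul]
      exact (mul_le_of_le_one_left (norm_nonneg _) (ha j (Finset.mem_insert_self _ _))).trans h2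

section Lyapunov

variable {S : Type*} [MeasurableSpace S] {P : Measure S} [IsProbabilityMeasure P]

theorem integrable_pow_of_memLp_four {X : S → ℝ} (hX : MemLp X 4 P) (k : ℕ) (hk : k ≤ 4) :
    Integrable (fun ω => X ω ^ k) P := by
  have h : MemLp X (k : ENNReal) P := hX.mono_exponent (by exact_mod_cast hk)
  rcases Nat.eq_zero_or_pos k with rfl | h0
  · simp
  have h2 := h.integrable_norm_pow h0.ne'
  refine (integrable_norm_iff (hX.1.pow k)).1 ?_
  simpa using h2

/-- Comparison with the characteristic function of the centered Gaussian of the same variance. The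
third absolute moment in the Taylor remainder is split between the second and the fourth moment,
with a free parameter `δ`. -/
theorem norm_charFun_sub_le {X : S → ℝ} (hX : MemLp X 4 P) (h0 : ∫ ω, X ω ∂P = 0)
    (t : ℝ) {δ : ℝ} (hδ : 0 < δ) :
    ‖charFun (P.map X) t - Complex.exp (-((t ^ 2 / 2 * ∫ ω, X ω ^ 2 ∂P : ℝ) : ℂ))‖ ≤
      2 * |t| ^ 3 * (δ * ∫ ω, X ω ^ 2 ∂P + (∫ ω, X ω ^ 4 ∂P) / δ)
        + t ^ 4 * ∫ ω, X ω ^ 4 ∂P := by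
  have i1 : Integrable X P := by simpa using integrable_pow_of_memLp_four hX 1 (by norm_num)
  have i2 := integrable_pow_of_memLp_four hX 2 (by norm_num)
  have i4 := integrable_pow_of_memLp_four hX 4 (by norm_num)
  set s := ∫ ω, X ω ^ 2 ∂P with hs
  set m := ∫ ω, X ω ^ 4 ∂P with hm
  have hs0 : 0 ≤ s := integral_nonneg fun _ => by positivity
  have hsm : s ^ 2 ≤ m := by
    have h2 : MemLp (fun ω => X ω ^ 2) 2 P := by
      refine (memLp_two_iff_integrable_sq i2.1).2 ?_
      simpa only [← pow_mul] using i4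
    have := variance_nonneg (fun ω => X ω ^ 2) P
    rw [variance_eq_sub h2] at this
    have h3 : ∫ ω, ((fun ω => X ω ^ 2) ^ 2) ω ∂P = m := by
      rw [hm]; congr 1; ext ω; simp only [Pi.pow_apply]; ring
    rw [h3] at this
    linarith
  have hc : charFun (P.map X) t = ∫ ω, Complex.exp ((t * X ω : ℝ) * Complex.I) ∂P := by
    rw [charFun_apply_real, integral_map hX.1.aemeasurable (by fun_prop)]
    simp
  have ie : Integrable (fun ω => Complex.exp ((t * X ω : ℝ) * Complex.I)) P := by
    refine Integrable.of_bound (C := 1) ?_ (ae_of_all _ fun ω => ?_)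
    · have hcont : Continuous fun x : ℝ => Complex.exp ((t * x : ℝ) * Complex.I) := by fun_prop
      exact hcont.comp_aestronglyMeasurable hX.1
    · rw [Complex.norm_exp_ofReal_mul_I]
  have ip : Integrable
      (fun ω => (1 + (t * X ω : ℝ) * Complex.I - (t * X ω : ℝ) ^ 2 / 2 : ℂ)) P := by
    refine ((integrable_const _).add ((i1.const_mul t).ofReal.mul_const _)).sub ?_
    refine ((i2.const_mul (t ^ 2)).ofReal.div_const 2).congr (ae_of_all _ fun ω => ?_)
    simp [mul_pow]
  have hp : ∫ ω, (1 + (t * X ω : ℝ) * Complex.I - (t * X ω : ℝ) ^ 2 / 2 : ℂ) ∂P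
      = ((1 - t ^ 2 / 2 * s : ℝ) : ℂ) := by
    have e2 : (fun ω => ((t * X ω : ℝ) : ℂ) ^ 2 / 2)
        = fun ω => ((t ^ 2 / 2 * X ω ^ 2 : ℝ) : ℂ) := by
      ext ω; push_cast; ring
    have j1 : Integrable (fun ω => ((t * X ω : ℝ) : ℂ) * Complex.I) P :=
      (i1.const_mul t).ofReal.mul_const _
    have j2 : Integrable (fun ω => 1 + ((t * X ω : ℝ) : ℂ) * Complex.I) P :=
      (integrable_const _).add j1
    have j3 : Integrable (fun ω => ((t * X ω : ℝ) : ℂ) ^ 2 / 2) P := by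
      rw [e2]; exact (i2.const_mul _).ofReal
    rw [integral_sub j2 j3, integral_add (integrable_const _) j1, e2, integral_mul_const,
      integral_complex_ofReal, integral_complex_ofReal, integral_const_mul, integral_const_mul,
      h0, ← hs]
    simp
  have k1 : ‖charFun (P.map X) t - ((1 - t ^ 2 / 2 * s : ℝ) : ℂ)‖
      ≤ 2 * |t| ^ 3 * (δ * s + m / δ) := by
    rw [hc, ← hp, ← integral_sub ie ip]
    refine (norm_integral_le_integral_norm _).trans ?_
    have : 2 * |t| ^ 3 * (δ * s + m / δ)
        = ∫ ω, 2 * |t| ^ 3 * (δ * X ω ^ 2 + X ω ^ 4 / δ) ∂P := by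
      rw [integral_const_mul, integral_add (i2.const_mul _) (i4.div_const _), integral_const_mul,
        integral_div]
    rw [this]
    refine integral_mono (ie.sub ip).norm (((i2.const_mul _).add (i4.div_const _)).const_mul _)
      fun ω => ?_
    refine (norm_cexp_mul_I_sub_le (t * X ω)).trans ?_
    rw [abs_mul, mul_pow]
    have h5 : 2 * |X ω| ^ 3 ≤ δ * X ω ^ 2 + X ω ^ 4 / δ := by
      have h6 : δ * X ω ^ 2 + X ω ^ 4 / δ - 2 * |X ω| ^ 3 = X ω ^ 2 * (δ - |X ω|) ^ 2 / δ := by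
        have h7 : X ω ^ 4 = |X ω| ^ 4 := by rw [← abs_pow, abs_of_nonneg (by positivity)]
        have h8 : X ω ^ 2 = |X ω| ^ 2 := (sq_abs _).symm
        rw [h7, h8]; field_simp; ring
      have : 0 ≤ X ω ^ 2 * (δ - |X ω|) ^ 2 / δ := by positivity
      linarith
    have : 0 ≤ |t| ^ 3 := by positivity
    nlinarith
  have k2 : ‖((1 - t ^ 2 / 2 * s : ℝ) : ℂ) - Complex.exp (-((t ^ 2 / 2 * s : ℝ) : ℂ))‖
      ≤ t ^ 4 * m := by
    rw [← Complex.ofReal_neg, ← Complex.ofReal_exp, ← Complex.ofReal_sub, Complex.norm_real,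
      Real.norm_eq_abs, abs_sub_comm]
    refine (abs_exp_neg_sub_le (by positivity)).trans ?_
    have : (t ^ 2 / 2 * s) ^ 2 = t ^ 4 * s ^ 2 / 4 := by ring
    rw [this]
    have : t ^ 4 * s ^ 2 ≤ t ^ 4 * m := mul_le_mul_of_nonneg_left hsm (by positivity)
    have : 0 ≤ t ^ 4 * s ^ 2 := by positivity
    linarith
  exact (norm_sub_le_norm_sub_add_norm_sub _ _ _).trans (add_le_add k1 k2)

/-- Independence makes both characteristic functions products over the summands, so that the errors
of the factors add up. -/
theorem norm_charFun_sum_sub_le {ι : Type*} [Fintype ι] {X : ι → S → ℝ} (hind : iIndepFun X P)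
    (hX : ∀ i, MemLp (X i) 4 P) (h0 : ∀ i, ∫ ω, X i ω ∂P = 0)
    (h1 : ∑ i, ∫ ω, X i ω ^ 2 ∂P = 1) (t : ℝ) {δ : ℝ} (hδ : 0 < δ) :
    ‖charFun (P.map fun ω => ∑ i, X i ω) t - Complex.exp (-(t ^ 2 / 2))‖ ≤
      2 * |t| ^ 3 * (δ + (∑ i, ∫ ω, X i ω ^ 4 ∂P) / δ) + t ^ 4 * ∑ i, ∫ ω, X i ω ^ 4 ∂P := by
  have e1 : Complex.exp (-(t ^ 2 / 2))
      = ∏ i, Complex.exp (-((t ^ 2 / 2 * ∫ ω, X i ω ^ 2 ∂P : ℝ) : ℂ)) := by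
    rw [← Complex.exp_sum, Finset.sum_neg_distrib, ← Complex.ofReal_sum, ← Finset.mul_sum, h1]
    simp
  rw [hind.charFun_map_fun_sum_eq_prod fun i => (hX i).1.aemeasurable, e1, Finset.prod_apply]
  have : ∀ i, IsProbabilityMeasure (P.map (X i)) := fun i =>
    Measure.isProbabilityMeasure_map (hX i).1.aemeasurable
  refine (norm_prod_sub_prod_le _ _ _ (fun i _ => norm_charFun_le_one t) fun i _ => ?_).trans ?_
  · rw [← Complex.ofReal_neg, ← Complex.ofReal_exp, Complex.norm_real, Real.norm_eq_abs,
      Real.abs_exp, Real.exp_le_one_iff, neg_nonpos]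
    exact mul_nonneg (by positivity) (integral_nonneg fun _ => by positivity)
  · refine (Finset.sum_le_sum fun i _ => norm_charFun_sub_le (hX i) (h0 i) t hδ).trans_eq ?_
    rw [Finset.sum_add_distrib, ← Finset.mul_sum, Finset.sum_add_distrib, ← Finset.mul_sum, h1,
      ← Finset.sum_div, ← Finset.mul_sum, mul_one]

end Lyapunov

/-- **Lyapunov's central limit theorem** for triangular arrays, under a fourth-moment condition. -/
theorem tendstoInDistribution_sum_of_fourth_moments {S : ℕ → Type*} [∀ n, MeasurableSpace (S n)]
    {P : ∀ n, Measure (S n)} [∀ n, IsProbabilityMeasure (P n)] {ι : ℕ → Type*}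
    [∀ n, Fintype (ι n)] {X : ∀ n, ι n → S n → ℝ} (hind : ∀ n, iIndepFun (X n) (P n))
    (hX : ∀ n i, MemLp (X n i) 4 (P n)) (h0 : ∀ n i, ∫ ω, X n i ω ∂P n = 0)
    (h1 : ∀ᶠ n in atTop, ∑ i, ∫ ω, X n i ω ^ 2 ∂P n = 1)
    (h4 : Tendsto (fun n => ∑ i, ∫ ω, X n i ω ^ 4 ∂P n) atTop (𝓝 0)) :
    TendstoInDistribution (fun n ω => ∑ i, X n i ω) atTop id P (gaussianReal 0 1) where
  forall_aemeasurable n := Finset.aemeasurable_fun_sum _ fun i _ => (hX n i).1.aemeasurable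
  aemeasurable_limit := aemeasurable_id
  tendsto := by
    refine ProbabilityMeasure.tendsto_iff_tendsto_charFun.2 fun t => ?_
    simp only [ProbabilityMeasure.coe_mk, Measure.map_id, charFun_gaussianReal]
    set L : ℕ → ℝ := fun n => ∑ i, ∫ ω, X n i ω ^ 4 ∂P n with hL
    have hL0 : ∀ n, 0 ≤ L n := fun n =>
      Finset.sum_nonneg fun i _ => integral_nonneg fun _ => by positivity
    -- the second summand keeps `δ n` positive where the fourth moments vanish
    set δ : ℕ → ℝ := fun n => √(L n) + 1 / ((n : ℝ) + 1) with hδ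
    have hδ0 : ∀ n, 0 < δ n := fun n => by positivity
    have hsq : Tendsto (fun n => √(L n)) atTop (𝓝 0) := by simpa using h4.sqrt
    have hδt : Tendsto δ atTop (𝓝 0) := by
      have := hsq.add (tendsto_one_div_add_atTop_nhds_zero_nat (𝕜 := ℝ))
      rwa [add_zero] at this
    have hq : ∀ n, L n / δ n ≤ √(L n) := fun n => by
      rw [div_le_iff₀ (hδ0 n)]
      calc L n = √(L n) * √(L n) := (Real.mul_self_sqrt (hL0 n)).symm
        _ ≤ √(L n) * δ n := by
          refine mul_le_mul_of_nonneg_left ?_ (Real.sqrt_nonneg _)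
          simp only [hδ, le_add_iff_nonneg_right]; positivity
    have hlim : Tendsto (fun n => 2 * |t| ^ 3 * (δ n + √(L n)) + t ^ 4 * L n) atTop (𝓝 0) := by
      simpa using ((hδt.add hsq).const_mul (2 * |t| ^ 3)).add (h4.const_mul (t ^ 4))
    rw [tendsto_iff_norm_sub_tendsto_zero]
    refine squeeze_zero' (Eventually.of_forall fun _ => norm_nonneg _) ?_ hlim
    filter_upwards [h1] with n hn
    have := norm_charFun_sum_sub_le (hind n) (hX n) (h0 n) hn t (hδ0 n)
    have e : Complex.exp (↑t * ↑(0 : ℝ) * Complex.I - ↑((1 : NNReal) : ℝ) * ↑t ^ 2 / 2)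
        = Complex.exp (-(t ^ 2 / 2)) := by
      congr 1; simp
    simp only [e] at *
    refine this.trans ?_
    have h3 : 0 ≤ 2 * |t| ^ 3 := by positivity
    have := mul_le_mul_of_nonneg_left (add_le_add_right (hq n) (δ n)) h3
    exact add_le_add_left this _

/-! ### Difference-in-differences weights -/

section DiffInDiff

variable {ι κ : Type*} [Fintype ι] [DecidableEq κ]

/-- The total treated weight in period `t` per unit untreated then; zero in the base period `z`. -/
noncomputable def controlShare (z : κ) (u ω : ι → κ → ℝ) (t : κ) : ℝ :=
  if t = z then 0 else (∑ i, ω i t) / ∑ i, u i t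

/-- The weights on untreated outcomes of the difference-in-differences estimator that compares the
change since the base period `z` of each treated observation with the average change among the
units untreated in the same period. The first summand, on the base period, makes up for the weights
on the later periods of the unit. Here `u` indicates the untreated observations, and `ω` holds
the weights on the treated observations and is zero elsewhere. -/
noncomputable def didWeight [Fintype κ] (z : κ) (u ω : ι → κ → ℝ) (i : ι) (t : κ) : ℝ :=
  (if t = z then -∑ s, ω i s + ∑ s, u i s * controlShare z u ω s else 0) - controlShare z u ω t

theorem sum_mul_controlShare {z : κ} {u ω : ι → κ → ℝ} (hω : ∀ i, ω i z = 0)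
    (h0 : ∀ t, ∑ i, u i t = 0 → ∑ i, ω i t = 0) (t : κ) :
    (∑ i, u i t) * controlShare z u ω t = ∑ i, ω i t := by
  unfold controlShare
  split_ifs with h
  · subst h; simp [hω]
  · by_cases h1 : ∑ i, u i t = 0
    · simp [h1, h0 t h1]
    · field_simp

/-- The difference-in-differences weights offset the unit and period effects in the treated
observations. -/
theorem sum_didWeight [Fintype κ] {z : κ} {u ω : ι → κ → ℝ} (hu : ∀ i, u i z = 1)
    (hω : ∀ i, ω i z = 0) (h0 : ∀ t, ∑ i, u i t = 0 → ∑ i, ω i t = 0) (a : ι → ℝ) (b : κ → ℝ) :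
    ∑ i, ∑ t, ω i t * (a i + b t) + ∑ i, ∑ t, u i t * (didWeight z u ω i t * (a i + b t)) = 0 := by
  set g := controlShare z u ω with hg
  have e1 : ∀ i, ∑ t, u i t * (didWeight z u ω i t * (a i + b t))
      = (-∑ s, ω i s + ∑ s, u i s * g s) * (a i + b z) - ∑ t, u i t * g t * (a i + b t) := by
    intro i
    rw [eq_sub_iff_add_eq, ← Finset.sum_add_distrib]
    rw [Finset.sum_eq_single z]
    · simp only [didWeight, if_true, hu, ← hg]; ring
    · intro t _ ht
      simp only [didWeight, if_neg ht, ← hg]; ring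
    · simp
  have e2 : ∀ i, ∑ t, ω i t * (a i + b t) + ∑ t, u i t * (didWeight z u ω i t * (a i + b t))
      = ∑ t, (ω i t - u i t * g t) * (b t - b z) := by
    intro i
    rw [e1, add_mul, neg_mul, Finset.sum_mul, Finset.sum_mul, ← Finset.sum_neg_distrib,
      ← Finset.sum_add_distrib, ← Finset.sum_sub_distrib, ← Finset.sum_add_distrib]
    exact Finset.sum_congr rfl fun t _ => by ring
  rw [← Finset.sum_add_distrib, Finset.sum_congr rfl fun i _ => e2 i, Finset.sum_comm]
  refine Finset.sum_eq_zero fun t _ => ?_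
  rw [← Finset.sum_mul, Finset.sum_sub_distrib, ← Finset.sum_mul, hg,
    sum_mul_controlShare hω h0, sub_self, zero_mul]

theorem sum_didWeight_sq_le [Fintype κ] {z : κ} {u ω : ι → κ → ℝ} (hu : ∀ i, u i z = 1)
    (hu2 : ∀ i t, u i t ^ 2 = u i t) :
    ∑ i, ∑ t, u i t * didWeight z u ω i t ^ 2 ≤ 2 * ∑ i, (∑ t, ω i t) ^ 2 +
      (2 * Fintype.card κ + 1) * ∑ t with t ≠ z, (∑ i, ω i t) ^ 2 / ∑ i, u i t := by
  set g := controlShare z u ω with hg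
  have gz : g z = 0 := by simp [hg, controlShare]
  have e1 : ∀ i, ∑ t, u i t * didWeight z u ω i t ^ 2
      = (-∑ s, ω i s + ∑ s, u i s * g s) ^ 2 + ∑ t, u i t * g t ^ 2 := by
    intro i
    rw [← sub_eq_iff_eq_add, ← Finset.sum_sub_distrib, Finset.sum_eq_single z]
    · simp only [didWeight, if_true, hu, ← hg, gz]; ring
    · intro t _ ht
      simp only [didWeight, if_neg ht, ← hg]; ring
    · simp
  have e2 : ∑ i, ∑ t, u i t * g t ^ 2 = ∑ t with t ≠ z, (∑ i, ω i t) ^ 2 / ∑ i, u i t := by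
    rw [Finset.sum_comm, Finset.sum_filter]
    refine Finset.sum_congr rfl fun t _ => ?_
    rw [← Finset.sum_mul]
    by_cases h : t = z
    · simp [h, gz]
    · simp only [hg, controlShare, h, if_false, ne_eq, not_false_eq_true, if_true]
      by_cases h1 : ∑ i, u i t = 0
      · simp [h1]
      · field_simp
  have e3 : ∀ i, (-∑ s, ω i s + ∑ s, u i s * g s) ^ 2
      ≤ 2 * (∑ s, ω i s) ^ 2 + 2 * Fintype.card κ * ∑ t, u i t * g t ^ 2 := by
    intro i
    have h1 := sq_sum_le_card_mul_sum_sq (s := Finset.univ) (f := fun s => u i s * g s)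
    simp only [mul_pow, hu2, Finset.card_univ] at h1
    nlinarith [sq_nonneg (∑ s, ω i s + ∑ s, u i s * g s)]
  calc ∑ i, ∑ t, u i t * didWeight z u ω i t ^ 2
      ≤ ∑ i, ((2 * (∑ s, ω i s) ^ 2 + 2 * Fintype.card κ * ∑ t, u i t * g t ^ 2)
          + ∑ t, u i t * g t ^ 2) :=
        Finset.sum_le_sum fun i _ => by rw [e1]; exact add_le_add_left (e3 i) _
    _ = _ := by
      rw [Finset.sum_add_distrib, Finset.sum_add_distrib, ← Finset.mul_sum, ← Finset.mul_sum, e2]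
      ring

end DiffInDiff

namespace Panel

/-! ### Implied weights of the least squares estimator -/

section Weights

variable {d : Panel}

theorem mem_treatedObs {p : Fin d.I × Fin d.T} :
    p ∈ d.treatedObs ↔ p ∈ d.obs ∧ d.Treated p.1 p.2 := by
  simp [treatedObs]

theorem mem_untreatedObs {p : Fin d.I × Fin d.T} :
    p ∈ d.untreatedObs ↔ p ∈ d.obs ∧ ¬ d.Treated p.1 p.2 := by
  simp [untreatedObs]

theorem sum_obs (d : Panel) (f : Fin d.I × Fin d.T → ℝ) :
    ∑ p ∈ d.obs, f p = ∑ p ∈ d.treatedObs, f p + ∑ p ∈ d.untreatedObs, f p := by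
  classical
  rw [← Finset.sum_filter_add_sum_filter_not d.obs (fun p => d.Treated p.1 p.2)]
  congr 1

theorem fitted_of_treated {p : Fin d.I × Fin d.T} (hp : p ∈ d.treatedObs) (θ : d.Coef) :
    d.fitted θ p.1 p.2 = θ.1 p.1 + θ.2.1 p.2 + θ.2.2 p.1 p.2 := by
  simp [fitted, (mem_treatedObs.1 hp).2]

theorem fitted_of_untreated {p : Fin d.I × Fin d.T} (hp : p ∈ d.untreatedObs) (θ : d.Coef) :
    d.fitted θ p.1 p.2 = θ.1 p.1 + θ.2.1 p.2 := by
  simp [fitted, (mem_untreatedObs.1 hp).2]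

/-- The normal equations. -/
theorem IsOLS.sum_residual_mul_fitted {y : Fin d.I → Fin d.T → ℝ} {θ : d.Coef} (h : d.IsOLS y θ)
    (θ' : d.Coef) :
    ∑ p ∈ d.obs, (y p.1 p.2 - d.fitted θ p.1 p.2) * d.fitted θ' p.1 p.2 = 0 := by
  set A := ∑ p ∈ d.obs, (y p.1 p.2 - d.fitted θ p.1 p.2) * d.fitted θ' p.1 p.2 with hA
  set B := ∑ p ∈ d.obs, d.fitted θ' p.1 p.2 ^ 2 with hB
  have hB0 : 0 ≤ B := Finset.sum_nonneg fun _ _ => sq_nonneg _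
  have hfit : ∀ (s : ℝ) i t, d.fitted (θ + s • θ') i t = d.fitted θ i t + s * d.fitted θ' i t := by
    intro s i t
    simp only [fitted, Prod.fst_add, Prod.snd_add, Pi.add_apply, Prod.smul_fst, Prod.smul_snd,
      Pi.smul_apply, smul_eq_mul]
    split_ifs <;> ring
  have key : ∀ s : ℝ, 0 ≤ -(2 * s * A) + s ^ 2 * B := by
    intro s
    have h1 := h (θ + s • θ')
    have h2 : d.ssr y (θ + s • θ') = d.ssr y θ + (-(2 * s * A) + s ^ 2 * B) := by
      simp only [ssr, hA, hB, hfit, Finset.mul_sum, ← Finset.sum_neg_distrib,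
        ← Finset.sum_add_distrib]
      exact Finset.sum_congr rfl fun p _ => by ring
    linarith
  -- perturbing along `θ'` by `s = A / (B + 1)` lowers the sum of squares unless `A = 0`
  have h3 := key (A / (B + 1))
  have h4 : -(2 * (A / (B + 1)) * A) + (A / (B + 1)) ^ 2 * B
      = -(A ^ 2 * (B + 2) / (B + 1) ^ 2) := by field_simp; ring
  rw [h4] at h3
  have h5 : A ^ 2 * (B + 2) / (B + 1) ^ 2 ≤ 0 := by linarith
  rw [div_le_iff₀ (by positivity)] at h5
  nlinarith [sq_nonneg A, mul_nonneg (sq_nonneg A) hB0]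

theorem IsOLS.eq_of_treated {y : Fin d.I → Fin d.T → ℝ} {θ : d.Coef} (h : d.IsOLS y θ)
    {p : Fin d.I × Fin d.T} (hp : p ∈ d.treatedObs) :
    y p.1 p.2 = θ.1 p.1 + θ.2.1 p.2 + θ.2.2 p.1 p.2 := by
  classical
  have h1 := h.sum_residual_mul_fitted (0, 0, Pi.single p.1 (Pi.single p.2 1))
  rw [Finset.sum_eq_single p] at h1
  · rw [fitted_of_treated hp, fitted_of_treated hp] at h1
    simp at h1
    linarith
  · intro q _ hq
    have : (Pi.single p.1 (Pi.single p.2 (1 : ℝ)) : Fin d.I → Fin d.T → ℝ) q.1 q.2 = 0 := by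
      by_cases h1 : q.1 = p.1
      · have h2 : q.2 ≠ p.2 := fun h2 => hq (Prod.ext h1 h2)
        rw [h1, Pi.single_eq_same, Pi.single_eq_of_ne h2]
      · rw [Pi.single_eq_of_ne h1]; rfl
    simp [fitted, this]
  · exact fun h2 => absurd (mem_treatedObs.1 hp).1 h2

theorem IsOLS.sum_untreated {y : Fin d.I → Fin d.T → ℝ} {θ : d.Coef} (h : d.IsOLS y θ)
    (a : Fin d.I → ℝ) (b : Fin d.T → ℝ) :
    ∑ p ∈ d.untreatedObs, (y p.1 p.2 - (θ.1 p.1 + θ.2.1 p.2)) * (a p.1 + b p.2) = 0 := by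
  have h1 := h.sum_residual_mul_fitted (a, b, 0)
  rw [sum_obs, Finset.sum_eq_zero, zero_add] at h1
  · rw [← h1]
    refine Finset.sum_congr rfl fun p hp => ?_
    rw [fitted_of_untreated hp, fitted_of_untreated hp]
  · intro p hp
    rw [fitted_of_treated hp, ← h.eq_of_treated hp]
    simp

/-- The linear estimator with weights `w` on treated and `v` on untreated observations is unaffected
by the unit and period fixed effects. -/
def Balanced (d : Panel) (w v : Fin d.I → Fin d.T → ℝ) : Prop :=
  ∀ (a : Fin d.I → ℝ) (b : Fin d.T → ℝ),
    ∑ p ∈ d.treatedObs, w p.1 p.2 * (a p.1 + b p.2) +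
      ∑ p ∈ d.untreatedObs, v p.1 p.2 * (a p.1 + b p.2) = 0

/-- Projecting balanced weights `v` on the untreated observations onto the space spanned by the
fixed effects gives balanced weights again, and these represent the estimator. -/
theorem Balanced.exists_eq_add {w v : Fin d.I → Fin d.T → ℝ} (h : d.Balanced w v) :
    ∃ (l : Fin d.I → ℝ) (m : Fin d.T → ℝ), d.Balanced w (fun i t => l i + m t) ∧
      ∀ y, d.estimator w y = ∑ p ∈ d.treatedObs, w p.1 p.2 * y p.1 p.2 +
        ∑ p ∈ d.untreatedObs, (l p.1 + m p.2) * y p.1 p.2 := by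
  obtain ⟨θ, hθ⟩ := d.exists_isOLS v
  have hb : d.Balanced w (fun i t => θ.1 i + θ.2.1 t) := by
    intro a b
    have h1 := hθ.sum_untreated a b
    simp only [sub_mul, Finset.sum_sub_distrib] at h1
    have h2 := h a b
    linarith
  refine ⟨θ.1, θ.2.1, hb, fun y => ?_⟩
  have hy := (d.exists_isOLS y).choose_spec
  set η := (d.exists_isOLS y).choose with hη
  have h1 := hy.sum_untreated θ.1 θ.2.1
  have h2 := hb η.1 η.2.1
  have h3 : d.estimator w y
      = ∑ p ∈ d.treatedObs, w p.1 p.2 * (y p.1 p.2 - (η.1 p.1 + η.2.1 p.2)) := by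
    refine Finset.sum_congr rfl fun p hp => ?_
    rw [hy.eq_of_treated hp, ← hη]
    ring
  rw [h3]
  simp only [mul_sub, sub_mul, Finset.sum_sub_distrib] at h1 ⊢
  have h4 : ∑ p ∈ d.untreatedObs, y p.1 p.2 * (θ.1 p.1 + θ.2.1 p.2)
      = ∑ p ∈ d.untreatedObs, (θ.1 p.1 + θ.2.1 p.2) * y p.1 p.2 :=
    Finset.sum_congr rfl fun _ _ => mul_comm _ _
  have h5 : ∑ p ∈ d.untreatedObs, (η.1 p.1 + η.2.1 p.2) * (θ.1 p.1 + θ.2.1 p.2)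
      = ∑ p ∈ d.untreatedObs, (θ.1 p.1 + θ.2.1 p.2) * (η.1 p.1 + η.2.1 p.2) :=
    Finset.sum_congr rfl fun _ _ => mul_comm _ _
  linarith

/-- The implied weights: `w` on treated observations, and a sum of a unit and a period component on
untreated ones. -/
theorem Balanced.impliedWeight {w v : Fin d.I → Fin d.T → ℝ} (h : d.Balanced w v) :
    (∀ p ∈ d.treatedObs, d.impliedWeight w p.1 p.2 = w p.1 p.2) ∧
    (∃ (l : Fin d.I → ℝ) (m : Fin d.T → ℝ),
      ∀ p ∈ d.untreatedObs, d.impliedWeight w p.1 p.2 = l p.1 + m p.2) ∧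
    d.Balanced w (d.impliedWeight w) ∧
    ∀ y, d.estimator w y = ∑ p ∈ d.obs, d.impliedWeight w p.1 p.2 * y p.1 p.2 := by
  classical
  obtain ⟨l, m, hb, he⟩ := h.exists_eq_add
  have hs : ∀ p q : Fin d.I × Fin d.T,
      (Pi.single p.1 (Pi.single p.2 (1 : ℝ)) : Fin d.I → Fin d.T → ℝ) q.1 q.2
        = if q = p then 1 else 0 := by
    rintro ⟨i, t⟩ ⟨j, s⟩
    simp only [Prod.mk.injEq]
    by_cases h1 : j = i
    · subst h1
      simp [Pi.single_apply]
    · simp [h1]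
  have hdisj : ∀ p, p ∈ d.treatedObs → p ∉ d.untreatedObs := fun p h1 h2 =>
    (mem_untreatedObs.1 h2).2 (mem_treatedObs.1 h1).2
  have hv : ∀ p : Fin d.I × Fin d.T, d.impliedWeight w p.1 p.2
      = (if p ∈ d.treatedObs then w p.1 p.2 else 0)
        + if p ∈ d.untreatedObs then l p.1 + m p.2 else 0 := by
    intro p
    rw [Panel.impliedWeight, he]
    simp only [hs, mul_ite, mul_one, mul_zero, Finset.sum_ite_eq']
  have h1 : ∀ p ∈ d.treatedObs, d.impliedWeight w p.1 p.2 = w p.1 p.2 := fun p hp => by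
    rw [hv, if_pos hp, if_neg (hdisj p hp), add_zero]
  have h2 : ∀ p ∈ d.untreatedObs, d.impliedWeight w p.1 p.2 = l p.1 + m p.2 := fun p hp => by
    rw [hv, if_pos hp, if_neg fun h => hdisj p h hp, zero_add]
  refine ⟨h1, ⟨l, m, h2⟩, fun a b => ?_, fun y => ?_⟩
  · rw [← hb a b]
    congr 1
    exact Finset.sum_congr rfl fun p hp => by rw [h2 p hp]
  · rw [he, sum_obs]
    congr 1
    · exact Finset.sum_congr rfl fun p hp => by rw [h1 p hp]
    · exact Finset.sum_congr rfl fun p hp => by rw [h2 p hp]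

/-- Efficiency (Gauss–Markov): among balanced weights on the untreated observations, the implied
ones have the smallest sum of squares. -/
theorem Balanced.sum_impliedWeight_sq_le {w v : Fin d.I → Fin d.T → ℝ} (h : d.Balanced w v) :
    ∑ p ∈ d.untreatedObs, d.impliedWeight w p.1 p.2 ^ 2
      ≤ ∑ p ∈ d.untreatedObs, v p.1 p.2 ^ 2 := by
  obtain ⟨-, ⟨l, m, hlm⟩, hb, -⟩ := h.impliedWeight
  have h1 := h l m
  have h2 := hb l m
  have h3 : ∑ p ∈ d.untreatedObs, v p.1 p.2 ^ 2
        - ∑ p ∈ d.untreatedObs, d.impliedWeight w p.1 p.2 ^ 2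
      = ∑ p ∈ d.untreatedObs, (v p.1 p.2 - d.impliedWeight w p.1 p.2) ^ 2
        + 2 * (∑ p ∈ d.untreatedObs, v p.1 p.2 * (l p.1 + m p.2)
          - ∑ p ∈ d.untreatedObs, d.impliedWeight w p.1 p.2 * (l p.1 + m p.2)) := by
    rw [← Finset.sum_sub_distrib, ← Finset.sum_sub_distrib, Finset.mul_sum,
      ← Finset.sum_add_distrib]
    exact Finset.sum_congr rfl fun p hp => by rw [hlm p hp]; ring
  have h4 : 0 ≤ ∑ p ∈ d.untreatedObs, (v p.1 p.2 - d.impliedWeight w p.1 p.2) ^ 2 :=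
    Finset.sum_nonneg fun _ _ => sq_nonneg _
  linarith

theorem sum_mem_eq_sum_ite [DecidableEq (Fin d.I × Fin d.T)] (s : Finset (Fin d.I × Fin d.T))
    (f : Fin d.I → Fin d.T → ℝ) :
    ∑ p ∈ s, f p.1 p.2 = ∑ i, ∑ t, if (i, t) ∈ s then f i t else 0 := by
  rw [← Fintype.sum_prod_type', ← Finset.sum_filter]
  simp

theorem sum_unit_eq_sum_ite [DecidableEq (Fin d.I × Fin d.T)] (s : Finset (Fin d.I × Fin d.T))
    (f : Fin d.I → Fin d.T → ℝ) (i : Fin d.I) :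
    ∑ p ∈ s with p.1 = i, f p.1 p.2 = ∑ t, if (i, t) ∈ s then f i t else 0 := by
  rw [Finset.sum_filter, sum_mem_eq_sum_ite s (fun j t => if j = i then f j t else 0),
    Finset.sum_eq_single i]
  · simp
  · intro j _ hj; simp [hj]
  · simp

theorem sum_period_eq_sum_ite [DecidableEq (Fin d.I × Fin d.T)] (s : Finset (Fin d.I × Fin d.T))
    (f : Fin d.I → Fin d.T → ℝ) (t : Fin d.T) :
    ∑ p ∈ s with p.2 = t, f p.1 p.2 = ∑ i, if (i, t) ∈ s then f i t else 0 := by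
  rw [Finset.sum_filter, sum_mem_eq_sum_ite s (fun j s => if s = t then f j s else 0)]
  refine Finset.sum_congr rfl fun i _ => ?_
  rw [Finset.sum_eq_single t]
  · simp
  · intro j _ hj; simp [hj]
  · simp

theorem numUntreated_eq_sum_ite [DecidableEq (Fin d.I × Fin d.T)] (t : Fin d.T) :
    (d.numUntreated t : ℝ) = ∑ i, if (i, t) ∈ d.untreatedObs then (1 : ℝ) else 0 := by
  rw [← sum_period_eq_sum_ite d.untreatedObs (fun _ _ => 1) t]
  simp [numUntreated]

/-- Where no unit is untreated, identification forces the treated weights of the period to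
cancel. -/
theorem Identified.sum_period_eq_zero {w : Fin d.I → Fin d.T → ℝ} (h : d.Identified w)
    {t : Fin d.T} (ht : d.numUntreated t = 0) : ∑ p ∈ d.treatedObs with p.2 = t, w p.1 p.2 = 0 := by
  classical
  have h1 := h 0 (Pi.single t 1) fun p hp => by
    have : p.2 ≠ t := fun h2 => by
      have h3 : p ∈ d.untreatedObs.filter fun p => p.2 = t := Finset.mem_filter.2 ⟨hp, h2⟩
      rw [numUntreated, Finset.card_eq_zero] at ht
      simp [ht] at h3
    simp [this]
  rw [Finset.sum_filter]
  refine Eq.trans (Finset.sum_congr rfl fun p _ => ?_) h1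
  simp [Pi.single_apply]

/-- Balanced weights exist, with a small sum of squares: the difference-in-differences weights
relative to the first period, in which every unit is untreated. -/
theorem exists_balanced {w : Fin d.I → Fin d.T → ℝ} (hid : d.Identified w)
    (hfirst : ∀ i, ∃ t : Fin d.T, (t : ℕ) = 0 ∧ (i, t) ∈ d.untreatedObs) :
    ∃ v : Fin d.I → Fin d.T → ℝ, d.Balanced w v ∧
      ∑ p ∈ d.untreatedObs, v p.1 p.2 ^ 2 ≤
        2 * ∑ i, (∑ p ∈ d.treatedObs with p.1 = i, w p.1 p.2) ^ 2 +
        (2 * d.T + 1) * ∑ t with 0 < Fin.val (n := d.T) t,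
          (∑ p ∈ d.treatedObs with p.2 = t, w p.1 p.2) ^ 2 / (d.numUntreated t : ℝ) := by
  classical
  rcases isEmpty_or_nonempty (Fin d.I) with hI | ⟨⟨i₀⟩⟩
  · have he : ∀ s : Finset (Fin d.I × Fin d.T), s = ∅ := fun s =>
      Finset.eq_empty_of_forall_notMem fun p => (hI.false p.1).elim
    refine ⟨0, fun a b => by simp [he], ?_⟩
    rw [he d.untreatedObs, Finset.sum_empty]
    positivity
  obtain ⟨z, hz, -⟩ := hfirst i₀
  have hfz : ∀ i, (i, z) ∈ d.untreatedObs := fun i => by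
    obtain ⟨t, ht, hm⟩ := hfirst i
    rwa [show z = t from Fin.ext (hz.trans ht.symm)]
  set u : Fin d.I → Fin d.T → ℝ := fun i t => if (i, t) ∈ d.untreatedObs then 1 else 0 with hu
  set ω : Fin d.I → Fin d.T → ℝ := fun i t => if (i, t) ∈ d.treatedObs then w i t else 0 with hω
  have hu1 : ∀ i, u i z = 1 := fun i => by simp [hu, hfz i]
  have hω0 : ∀ i, ω i z = 0 := fun i => by
    have : (i, z) ∉ d.treatedObs := fun h =>
      (mem_untreatedObs.1 (hfz i)).2 (mem_treatedObs.1 h).2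
    simp [hω, this]
  have hW : ∀ t, ∑ i, ω i t = ∑ p ∈ d.treatedObs with p.2 = t, w p.1 p.2 := fun t =>
    (sum_period_eq_sum_ite _ _ t).symm
  have hN : ∀ t, ∑ i, u i t = (d.numUntreated t : ℝ) := fun t => (numUntreated_eq_sum_ite t).symm
  have hR : ∀ i, ∑ t, ω i t = ∑ p ∈ d.treatedObs with p.1 = i, w p.1 p.2 := fun i =>
    (sum_unit_eq_sum_ite _ _ i).symm
  refine ⟨didWeight z u ω, fun a b => ?_, ?_⟩
  · rw [← sum_didWeight hu1 hω0 (fun t ht => ?_) a b,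
      sum_mem_eq_sum_ite d.treatedObs (fun i t => w i t * (a i + b t)),
      sum_mem_eq_sum_ite d.untreatedObs (fun i t => didWeight z u ω i t * (a i + b t))]
    · simp only [hu, hω, ite_mul, zero_mul, one_mul]
    · rw [hW]
      rw [hN] at ht
      exact hid.sum_period_eq_zero (by exact_mod_cast ht)
  · have h1 := sum_didWeight_sq_le (ω := ω) hu1 fun i t => by
      simp only [hu]; split_ifs <;> norm_num
    have h2 : (Finset.univ.filter fun t : Fin d.T => 0 < t.val)
        = Finset.univ.filter fun t => t ≠ z := by
      ext t
      simp [Fin.ext_iff, hz, Nat.pos_iff_ne_zero]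
    rw [sum_mem_eq_sum_ite d.untreatedObs (fun i t => didWeight z u ω i t ^ 2), h2]
    simp only [hW, hN, hR, Fintype.card_fin] at h1
    refine le_trans (le_of_eq ?_) h1
    refine Finset.sum_congr rfl fun i _ => Finset.sum_congr rfl fun t _ => ?_
    simp only [hu, ite_mul, zero_mul, one_mul]

theorem herfindahl_eq (d : Panel) (w : Fin d.I → Fin d.T → ℝ) :
    d.herfindahl w = ∑ i, (∑ p ∈ d.obs with p.1 = i, |d.impliedWeight w p.1 p.2|) ^ 2 := by
  classical
  refine Finset.sum_congr rfl fun i _ => ?_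
  rw [sum_unit_eq_sum_ite d.obs (fun i t => |d.impliedWeight w i t|), ← Finset.sum_filter]

theorem sum_obs_unit (d : Panel) (f : Fin d.I × Fin d.T → ℝ) (i : Fin d.I) :
    ∑ p ∈ d.obs with p.1 = i, f p = ∑ p ∈ d.treatedObs with p.1 = i, f p
      + ∑ p ∈ d.untreatedObs with p.1 = i, f p := by
  rw [Finset.sum_filter, sum_obs, ← Finset.sum_filter, ← Finset.sum_filter]

/-- The clustered Herfindahl index is controlled by the three quantities in the rate conditions. -/
theorem herfindahl_le {w : Fin d.I → Fin d.T → ℝ} (hid : d.Identified w)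
    (hfirst : ∀ i, ∃ t : Fin d.T, (t : ℕ) = 0 ∧ (i, t) ∈ d.untreatedObs) :
    d.herfindahl w ≤ 2 * ∑ i, (∑ p ∈ d.treatedObs with p.1 = i, |w p.1 p.2|) ^ 2 +
      4 * (d.T * ∑ i, (∑ p ∈ d.treatedObs with p.1 = i, w p.1 p.2) ^ 2) +
      6 * ((d.T : ℝ) ^ 2 * ∑ t with 0 < Fin.val (n := d.T) t,
          (∑ p ∈ d.treatedObs with p.2 = t, w p.1 p.2) ^ 2 / (d.numUntreated t : ℝ)) := by
  classical
  obtain ⟨v, hb, hv⟩ := exists_balanced hid hfirst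
  have h1 := hb.sum_impliedWeight_sq_le.trans hv
  obtain ⟨ht, -⟩ := hb.impliedWeight
  set R := ∑ i, (∑ p ∈ d.treatedObs with p.1 = i, |w p.1 p.2|) ^ 2
  set A := ∑ i, (∑ p ∈ d.treatedObs with p.1 = i, w p.1 p.2) ^ 2
  set B := ∑ t with 0 < Fin.val (n := d.T) t,
          (∑ p ∈ d.treatedObs with p.2 = t, w p.1 p.2) ^ 2 / (d.numUntreated t : ℝ) with hB
  have hB0 : 0 ≤ B := by positivity
  have hu : ∀ i, (∑ p ∈ d.untreatedObs with p.1 = i, |d.impliedWeight w p.1 p.2|) ^ 2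
      ≤ d.T * ∑ p ∈ d.untreatedObs with p.1 = i, d.impliedWeight w p.1 p.2 ^ 2 := by
    intro i
    rw [sum_unit_eq_sum_ite d.untreatedObs (fun i t => |d.impliedWeight w i t|),
      sum_unit_eq_sum_ite d.untreatedObs (fun i t => d.impliedWeight w i t ^ 2)]
    refine (sq_sum_le_card_mul_sum_sq).trans_eq ?_
    rw [Finset.card_univ, Fintype.card_fin]
    congr 1
    refine Finset.sum_congr rfl fun t _ => ?_
    split_ifs <;> simp
  have hfib : ∑ i, ∑ p ∈ d.untreatedObs with p.1 = i, d.impliedWeight w p.1 p.2 ^ 2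
      = ∑ p ∈ d.untreatedObs, d.impliedWeight w p.1 p.2 ^ 2 :=
    Finset.sum_fiberwise _ _ _
  have h2 : d.herfindahl w ≤ 2 * R
      + 2 * (d.T * ∑ p ∈ d.untreatedObs, d.impliedWeight w p.1 p.2 ^ 2) := by
    rw [herfindahl_eq, ← hfib, Finset.mul_sum, Finset.mul_sum, Finset.mul_sum,
      ← Finset.sum_add_distrib]
    refine Finset.sum_le_sum fun i _ => ?_
    rw [sum_obs_unit]
    have h3 : ∑ p ∈ d.treatedObs with p.1 = i, |d.impliedWeight w p.1 p.2|
        = ∑ p ∈ d.treatedObs with p.1 = i, |w p.1 p.2| :=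
      Finset.sum_congr rfl fun p hp => by rw [ht p (Finset.mem_filter.1 hp).1]
    rw [h3]
    have := hu i
    nlinarith [sq_nonneg (∑ p ∈ d.treatedObs with p.1 = i, |w p.1 p.2|
      - ∑ p ∈ d.untreatedObs with p.1 = i, |d.impliedWeight w p.1 p.2|)]
  have hT0 : (0 : ℝ) ≤ d.T := by positivity
  have hT : (d.T : ℝ) ≤ (d.T : ℝ) ^ 2 := by exact_mod_cast Nat.le_self_pow (by norm_num) _
  have h3 := mul_le_mul_of_nonneg_left h1 hT0
  have h4 := mul_le_mul_of_nonneg_right hT hB0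
  nlinarith

end Weights

end Panel

/-! ### The estimation error of one panel -/

theorem abs_covariance_le {S : Type*} [MeasurableSpace S] {P : Measure S} [IsProbabilityMeasure P]
    {X Y : S → ℝ} (hX : MemLp X 2 P) (hY : MemLp Y 2 P) {s : ℝ} (h1 : variance X P ≤ s)
    (h2 : variance Y P ≤ s) : |covariance X Y P| ≤ s := by
  have h3 := variance_nonneg (X + Y) P
  have h4 := variance_nonneg (X - Y) P
  rw [variance_add hX hY] at h3
  rw [variance_sub hX hY] at h4
  rw [abs_le]
  constructor <;> linarith

namespace Panel

section Error

variable {d : Panel} {S : Type*} [MeasurableSpace S] {P : Measure S}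
  {w v : Fin d.I → Fin d.T → ℝ} {Y Y0 : Fin d.I → Fin d.T → S → ℝ} {σ2 : ℝ}

theorem memLp_err [IsProbabilityMeasure P] {q : ENNReal} {i : Fin d.I} {t : Fin d.T}
    (h : MemLp (Y i t) q P) :
    MemLp (d.err P Y i t) q P :=
  h.sub (memLp_const _)

theorem integral_err [IsProbabilityMeasure P] {i : Fin d.I} {t : Fin d.T}
    (h : Integrable (Y i t) P) :
    ∫ ω, d.err P Y i t ω ∂P = 0 := by
  simp only [err]
  rw [integral_sub h (integrable_const _)]
  simp

/-- Balance removes the fixed effects, so that the estimation error is the implied-weighted sum of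
the error terms. -/
theorem tauHat_sub_target (hv : d.Balanced w v) (hpt : d.ParallelTrends P Y0)
    (hna : d.NoAnticipation P Y Y0) (hY : ∀ p ∈ d.obs, Integrable (Y p.1 p.2) P) (ω : S) :
    d.tauHat w Y ω - d.target P w Y Y0
      = ∑ p ∈ d.obs, d.impliedWeight w p.1 p.2 * d.err P Y p.1 p.2 ω := by
  obtain ⟨ht, -, hb, he⟩ := hv.impliedWeight
  obtain ⟨a, b, hab⟩ := hpt
  simp only [err, mul_sub, Finset.sum_sub_distrib]
  rw [tauHat, he, sub_right_inj, sum_obs]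
  have h1 : ∑ p ∈ d.treatedObs, d.impliedWeight w p.1 p.2 * ∫ ω, Y p.1 p.2 ω ∂P
      = ∑ p ∈ d.treatedObs, w p.1 p.2 * ∫ ω, Y p.1 p.2 ω ∂P :=
    Finset.sum_congr rfl fun p hp => by rw [ht p hp]
  have h2 : ∑ p ∈ d.untreatedObs, d.impliedWeight w p.1 p.2 * ∫ ω, Y p.1 p.2 ω ∂P
      = ∑ p ∈ d.untreatedObs, d.impliedWeight w p.1 p.2 * (a p.1 + b p.2) :=
    Finset.sum_congr rfl fun p hp => by
      rw [integral_congr_ae (hna p hp), (hab p (mem_untreatedObs.1 hp).1).2]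
  have h3 : d.target P w Y Y0 = ∑ p ∈ d.treatedObs, w p.1 p.2 * ∫ ω, Y p.1 p.2 ω ∂P
      - ∑ p ∈ d.treatedObs, w p.1 p.2 * (a p.1 + b p.2) := by
    rw [target, ← Finset.sum_sub_distrib]
    refine Finset.sum_congr rfl fun p hp => ?_
    have hp' := (mem_treatedObs.1 hp).1
    rw [integral_sub (hY p hp') (hab p hp').1, (hab p hp').2, mul_sub]
  have h4 := hb a b
  rw [h1, h2, h3]
  linarith

/-- Only pairs of observations of the same unit contribute to the variance. -/
theorem variance_error_le [IsProbabilityMeasure P] (hcl : d.ClusteredErrors P Y σ2)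
    (v : Fin d.I → Fin d.T → ℝ) :
    variance (fun ω => ∑ p ∈ d.obs, v p.1 p.2 * d.err P Y p.1 p.2 ω) P
      ≤ σ2 * ∑ i, (∑ p ∈ d.obs with p.1 = i, |v p.1 p.2|) ^ 2 := by
  obtain ⟨h1, h2⟩ := hcl
  have hm : ∀ p ∈ d.obs, MemLp (d.err P Y p.1 p.2) 2 P := fun p hp => memLp_err (h1 p hp).1
  rw [variance_fun_sum' fun p hp => (hm p hp).const_mul _]
  simp only [covariance_const_mul_left, covariance_const_mul_right]
  have key : ∀ p ∈ d.obs, ∑ q ∈ d.obs,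
      v q.1 q.2 * (v p.1 p.2 * covariance (d.err P Y p.1 p.2) (d.err P Y q.1 q.2) P)
      ≤ σ2 * (|v p.1 p.2| * ∑ q ∈ d.obs with q.1 = p.1, |v q.1 q.2|) := by
    intro p hp
    rw [Finset.sum_filter, Finset.mul_sum, Finset.mul_sum]
    refine Finset.sum_le_sum fun q hq => ?_
    rw [mul_left_comm]
    split_ifs with h
    · have h3 := abs_covariance_le (hm p hp) (hm q hq) (h1 p hp).2 (h1 q hq).2
      refine (le_abs_self _).trans ?_
      rw [abs_mul, abs_mul]
      have : 0 ≤ |v p.1 p.2| * |v q.1 q.2| := by positivity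
      nlinarith
    · rw [h2 p hp q hq (Ne.symm h)]
      simp
  refine (Finset.sum_le_sum key).trans_eq ?_
  rw [← Finset.mul_sum]
  congr 1
  rw [← Finset.sum_fiberwise d.obs (fun p => p.1)]
  refine Finset.sum_congr rfl fun i _ => ?_
  rw [sq, Finset.sum_mul]
  refine Finset.sum_congr rfl fun p hp => ?_
  rw [(Finset.mem_filter.1 hp).2]

/-- The estimation error has mean zero, and its variance is that of the estimator. -/
theorem estimation_error [IsProbabilityMeasure P] (hv : d.Balanced w v)
    (hpt : d.ParallelTrends P Y0) (hna : d.NoAnticipation P Y Y0) (hcl : d.ClusteredErrors P Y σ2) :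
    MemLp (fun ω => d.tauHat w Y ω - d.target P w Y Y0) 2 P ∧
    ∫ ω, (d.tauHat w Y ω - d.target P w Y Y0) ∂P = 0 ∧
    variance (fun ω => d.tauHat w Y ω - d.target P w Y Y0) P = variance (d.tauHat w Y) P ∧
    variance (fun ω => d.tauHat w Y ω - d.target P w Y Y0) P ≤ σ2 * d.herfindahl w := by
  have hY : ∀ p ∈ d.obs, Integrable (Y p.1 p.2) P := fun p hp =>
    (hcl.1 p hp).1.integrable (by norm_num)
  have he : (fun ω => d.tauHat w Y ω - d.target P w Y Y0)
      = fun ω => ∑ p ∈ d.obs, d.impliedWeight w p.1 p.2 * d.err P Y p.1 p.2 ω :=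
    funext fun ω => tauHat_sub_target hv hpt hna hY ω
  have hm : ∀ p ∈ d.obs,
      MemLp (fun ω => d.impliedWeight w p.1 p.2 * d.err P Y p.1 p.2 ω) 2 P := fun p hp =>
    (memLp_err (hcl.1 p hp).1).const_mul _
  have hM : MemLp (fun ω => d.tauHat w Y ω - d.target P w Y Y0) 2 P := by
    rw [he]; exact memLp_finsetSum _ hm
  refine ⟨hM, ?_, ?_, ?_⟩
  · rw [he, integral_finsetSum _ fun p hp => (hm p hp).integrable (by norm_num)]
    refine Finset.sum_eq_zero fun p hp => ?_
    rw [integral_const_mul, integral_err (hY p hp), mul_zero]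
  · refine variance_sub_const ?_ _
    have := hM.1.add (aestronglyMeasurable_const (b := d.target P w Y Y0))
    refine this.congr (ae_of_all _ fun ω => ?_)
    simp
  · rw [he, herfindahl_eq]
    exact variance_error_le hcl _

end Error

/-! ### Implied weights in complete panels -/

section Complete

variable {d : Panel} {w v : Fin d.I → Fin d.T → ℝ}

theorem sum_unit_of_complete (hc : d.obs = Finset.univ) (f : Fin d.I → Fin d.T → ℝ) (i : Fin d.I) :
    ∑ p ∈ d.obs with p.1 = i, f p.1 p.2 = ∑ t, f i t := by
  classical
  rw [sum_unit_eq_sum_ite]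
  simp [hc]

theorem herfindahl_of_complete (hc : d.obs = Finset.univ) :
    d.herfindahl w = ∑ i, (∑ t, |d.impliedWeight w i t|) ^ 2 := by
  rw [herfindahl_eq]
  exact Finset.sum_congr rfl fun i _ => by
    rw [sum_unit_of_complete hc (fun i t => |d.impliedWeight w i t|)]

/-- Balance against the fixed effect of unit `i`. -/
theorem sum_impliedWeight_eq_zero (hc : d.obs = Finset.univ) (hv : d.Balanced w v) (i : Fin d.I) :
    ∑ t, d.impliedWeight w i t = 0 := by
  obtain ⟨ht, -, hb, -⟩ := hv.impliedWeight
  have h1 := hb (Pi.single i 1) 0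
  have h2 : ∑ p ∈ d.treatedObs,
        w p.1 p.2 * ((Pi.single i 1 : Fin d.I → ℝ) p.1 + (0 : Fin d.T → ℝ) p.2)
      = ∑ p ∈ d.treatedObs,
        d.impliedWeight w p.1 p.2 * ((Pi.single i 1 : Fin d.I → ℝ) p.1 + (0 : Fin d.T → ℝ) p.2) :=
    Finset.sum_congr rfl fun p hp => by rw [ht p hp]
  rw [h2, ← sum_obs d (fun p => d.impliedWeight w p.1 p.2 *
    ((Pi.single i 1 : Fin d.I → ℝ) p.1 + (0 : Fin d.T → ℝ) p.2))] at h1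
  rw [← sum_unit_of_complete hc, Finset.sum_filter]
  refine Eq.trans (Finset.sum_congr rfl fun p _ => ?_) h1
  simp [Pi.single_apply]

/-- Within a cohort the untreated implied weights of two units differ by a constant over time, which
is pinned down by the treated weights since the implied weights of each unit sum to zero. -/
theorem sum_abs_impliedWeight_le_of_cohort (hc : d.obs = Finset.univ) (hv : d.Balanced w v)
    {C : ℝ} (hC : 0 ≤ C) {i j : Fin d.I} (hij : d.E i = d.E j)
    (hw : ∀ t, d.Treated i t → |w i t| ≤ C * |w j t|) :
    ∑ t, |d.impliedWeight w i t| ≤ (1 + 2 * C) * ∑ t, |d.impliedWeight w j t| := by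
  classical
  have hz := fun i => sum_impliedWeight_eq_zero hc hv i
  obtain ⟨ht, ⟨l, m, hlm⟩, -, -⟩ := hv.impliedWeight
  set x := d.impliedWeight w with hx
  have hT : ∀ t, d.Treated j t ↔ d.Treated i t := fun t => by simp [Treated, hij]
  have hti : ∀ t, d.Treated i t → x i t = w i t := fun t h =>
    ht (i, t) (mem_treatedObs.2 ⟨by simp [hc], h⟩)
  have htj : ∀ t, d.Treated i t → x j t = w j t := fun t h =>
    ht (j, t) (mem_treatedObs.2 ⟨by simp [hc], (hT t).2 h⟩)
  have hui : ∀ t, ¬ d.Treated i t → x i t - x j t = l i - l j := fun t h => by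
    have h1 : x i t = l i + m t := hlm (i, t) (mem_untreatedObs.2 ⟨by simp [hc], h⟩)
    have h2 : x j t = l j + m t :=
      hlm (j, t) (mem_untreatedObs.2 ⟨by simp [hc], fun h3 => h ((hT t).1 h3)⟩)
    rw [h1, h2]; ring
  have split := fun f : Fin d.T → ℝ =>
    (Finset.sum_filter_add_sum_filter_not Finset.univ (fun t => d.Treated i t) f).symm
  have h1 : ∑ t with ¬ d.Treated i t, |x i t - x j t|
      ≤ ∑ t with d.Treated i t, |x i t| + ∑ t with d.Treated i t, |x j t| := by
    have h2 : ∑ t with ¬ d.Treated i t, |x i t - x j t|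
        = |∑ t with ¬ d.Treated i t, (x i t - x j t)| := by
      have e1 : ∑ t with ¬ d.Treated i t, |x i t - x j t|
          = ∑ t with ¬ d.Treated i t, |l i - l j| :=
        Finset.sum_congr rfl fun t h => by rw [hui t (Finset.mem_filter.1 h).2]
      have e2 : ∑ t with ¬ d.Treated i t, (x i t - x j t)
          = ∑ t with ¬ d.Treated i t, (l i - l j) :=
        Finset.sum_congr rfl fun t h => hui t (Finset.mem_filter.1 h).2
      rw [e1, e2, Finset.sum_const, Finset.sum_const, nsmul_eq_mul, nsmul_eq_mul, abs_mul,
        Nat.abs_cast]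
    have h3 : ∑ t with ¬ d.Treated i t, (x i t - x j t)
        = -∑ t with d.Treated i t, (x i t - x j t) := by
      have := split fun t => x i t - x j t
      rw [Finset.sum_sub_distrib, hz, hz] at this
      linarith
    rw [h2, h3, abs_neg, ← Finset.sum_add_distrib]
    exact (Finset.abs_sum_le_sum_abs _ _).trans
      (Finset.sum_le_sum fun t _ => abs_sub _ _)
  have h2 : ∑ t with ¬ d.Treated i t, |x i t| ≤ ∑ t with ¬ d.Treated i t, |x j t|
      + ∑ t with ¬ d.Treated i t, |x i t - x j t| := by
    rw [← Finset.sum_add_distrib]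
    refine Finset.sum_le_sum fun t _ => ?_
    have := abs_add_le (x j t) (x i t - x j t)
    rwa [add_sub_cancel] at this
  have h3 : ∑ t with d.Treated i t, |x i t| ≤ C * ∑ t with d.Treated i t, |x j t| := by
    rw [Finset.mul_sum]
    refine Finset.sum_le_sum fun t h => ?_
    have h := (Finset.mem_filter.1 h).2
    rw [hti t h, htj t h]
    exact hw t h
  have h4 : 0 ≤ ∑ t with ¬ d.Treated i t, |x j t| := Finset.sum_nonneg fun _ _ => abs_nonneg _
  have h5 := mul_nonneg hC h4
  rw [split fun t => |x i t|, split fun t => |x j t|]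
  nlinarith

/-- In a complete panel with comparable weights, the share of a unit in the Herfindahl index is at
most inversely proportional to the size of its cohort. -/
theorem cohortSize_mul_sq_le (hc : d.obs = Finset.univ) (hv : d.Balanced w v) {C : ℝ} (hC : 0 ≤ C)
    (hw : ∀ i j t, d.E i = d.E j → d.Treated i t → |w i t| ≤ C * |w j t|) (i : Fin d.I) :
    d.cohortSize (d.E i) * (∑ t, |d.impliedWeight w i t|) ^ 2
      ≤ (1 + 2 * C) ^ 2 * d.herfindahl w := by
  classical
  rw [herfindahl_of_complete hc, cohortSize, Finset.mul_sum, ← nsmul_eq_mul, ← Finset.sum_const]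
  refine (Finset.sum_le_sum (g := fun j => (1 + 2 * C) ^ 2 * (∑ t, |d.impliedWeight w j t|) ^ 2)
    fun j hj => ?_).trans (Finset.sum_le_sum_of_subset_of_nonneg (Finset.subset_univ _)
      fun _ _ _ => by positivity)
  rw [← mul_pow]
  have hj := (Finset.mem_filter.1 hj).2.symm
  exact pow_le_pow_left₀ (Finset.sum_nonneg fun _ _ => abs_nonneg _)
    (sum_abs_impliedWeight_le_of_cohort hc hv hC hj fun t => hw i j t hj) 2

/-- A single weight is at most of the order of the average absolute weight in its cohort and
period. -/
theorem cohortSize_mul_abs_le (hc : d.obs = Finset.univ) {C : ℝ} (hC : 0 ≤ C)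
    (hw : ∀ i j t, d.E i = d.E j → d.Treated i t → |w i t| ≤ C * |w j t|) {i : Fin d.I}
    {t : Fin d.T} (ht : d.Treated i t) :
    d.cohortSize (d.E i) * |w i t| ≤ C * ∑ p ∈ d.treatedObs, |w p.1 p.2| := by
  classical
  rw [cohortSize, ← nsmul_eq_mul, ← Finset.sum_const]
  set F := Finset.univ.filter fun j : Fin d.I => d.E j = d.E i with hF
  have h1 : ∑ j ∈ F, |w i t| ≤ C * ∑ j ∈ F, |w j t| := by
    rw [Finset.mul_sum]
    exact Finset.sum_le_sum fun j hj => hw i j t (Finset.mem_filter.1 hj).2.symm ht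
  refine h1.trans (mul_le_mul_of_nonneg_left ?_ hC)
  have h2 : ∑ j ∈ F, |w j t| = ∑ p ∈ F ×ˢ {t}, |w p.1 p.2| := by
    rw [Finset.sum_product]; simp
  rw [h2]
  refine Finset.sum_le_sum_of_subset_of_nonneg (fun p hp => ?_) fun _ _ _ => abs_nonneg _
  rw [Finset.mem_product, Finset.mem_singleton] at hp
  refine mem_treatedObs.2 ⟨by simp [hc], ?_⟩
  rw [Treated, hp.2, (Finset.mem_filter.1 hp.1).2]
  exact ht

theorem cohortSize_le_numUntreated (hc : d.obs = Finset.univ) {i : Fin d.I} {t : Fin d.T}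
    (ht : ¬ d.Treated i t) : d.cohortSize (d.E i) ≤ d.numUntreated t := by
  classical
  rw [cohortSize, numUntreated]
  refine Finset.card_le_card_of_injOn (fun j => (j, t)) (fun j hj => ?_)
    fun _ _ _ _ h => (Prod.mk.inj h).1
  have hj := (Finset.mem_filter.1 hj).2
  simp only [Finset.coe_filter, Set.mem_ofPred_eq, and_true]
  refine mem_untreatedObs.2 ⟨by simp [hc], ?_⟩
  rw [Treated, hj]
  exact ht

/-- When cohorts are proportional to the number of units, the Herfindahl index is of the order of
the inverse number of units. -/
theorem units_mul_herfindahl_le (hc : d.obs = Finset.univ) (hid : d.Identified w)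
    (hfirst : ∀ i, ∃ t : Fin d.T, (t : ℕ) = 0 ∧ (i, t) ∈ d.untreatedObs) {C : ℝ} (hC : 0 ≤ C)
    (hw : ∀ i j t, d.E i = d.E j → d.Treated i t → |w i t| ≤ C * |w j t|) {c : ℝ} (hc0 : 0 < c)
    (hshare : ∀ e, d.cohortSize e = 0 ∨ c * (d.I : ℝ) ≤ (d.cohortSize e : ℝ)) {B : ℝ}
    (hB : ∑ p ∈ d.treatedObs, |w p.1 p.2| ≤ B) :
    d.I * d.herfindahl w ≤ (2 + 4 * d.T) * (d.T * (C * B / c)) ^ 2 + 6 * d.T ^ 3 * (B ^ 2 / c) := by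
  classical
  have hB0 : 0 ≤ B := (Finset.sum_nonneg fun _ _ => abs_nonneg _).trans hB
  rcases Nat.eq_zero_or_pos d.I with hI | hI
  · rw [hI, Nat.cast_zero, zero_mul]; positivity
  have hI' : (0 : ℝ) < d.I := by exact_mod_cast hI
  have hsh : ∀ i, c * (d.I : ℝ) ≤ d.cohortSize (d.E i) := fun i => by
    refine (hshare (d.E i)).resolve_left fun h => ?_
    rw [cohortSize, Finset.card_eq_zero, Finset.filter_eq_empty_iff] at h
    exact h (Finset.mem_univ i) rfl
  have hwb : ∀ p ∈ d.treatedObs, |w p.1 p.2| ≤ C * B / c / d.I := by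
    intro p hp
    rw [div_div, le_div_iff₀ (by positivity), mul_comm]
    refine (mul_le_mul_of_nonneg_right (hsh p.1) (abs_nonneg _)).trans ?_
    exact (cohortSize_mul_abs_le hc hC hw (mem_treatedObs.1 hp).2).trans
      (mul_le_mul_of_nonneg_left hB hC)
  have hrow : ∀ i, ∑ p ∈ d.treatedObs with p.1 = i, |w p.1 p.2| ≤ d.T * (C * B / c / d.I) := by
    intro i
    rw [sum_unit_eq_sum_ite d.treatedObs (fun i t => |w i t|)]
    refine (Finset.sum_le_card_nsmul _ _ (C * B / c / d.I) fun t _ => ?_).trans_eq (by simp)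
    split_ifs with h
    · exact hwb (i, t) h
    · positivity
  have hR : ∀ i, (∑ p ∈ d.treatedObs with p.1 = i, |w p.1 p.2|) ^ 2
      ≤ (d.T * (C * B / c)) ^ 2 / d.I ^ 2 := by
    intro i
    rw [← div_pow, mul_div_assoc]
    exact pow_le_pow_left₀ (Finset.sum_nonneg fun _ _ => abs_nonneg _) (hrow i) 2
  have hA : ∀ i, (∑ p ∈ d.treatedObs with p.1 = i, w p.1 p.2) ^ 2
      ≤ (∑ p ∈ d.treatedObs with p.1 = i, |w p.1 p.2|) ^ 2 := by
    intro i
    rw [← sq_abs]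
    exact pow_le_pow_left₀ (abs_nonneg _) (Finset.abs_sum_le_sum_abs _ _) 2
  have hP : ∀ t, (∑ p ∈ d.treatedObs with p.2 = t, w p.1 p.2) ^ 2 / (d.numUntreated t : ℝ)
      ≤ B ^ 2 / c / d.I := by
    intro t
    by_cases h : ∃ i, ¬ d.Treated i t
    · obtain ⟨i, hi⟩ := h
      have h1 : c * d.I ≤ d.numUntreated t :=
        (hsh i).trans (by exact_mod_cast cohortSize_le_numUntreated hc hi)
      have h2 : |∑ p ∈ d.treatedObs with p.2 = t, w p.1 p.2| ≤ B :=
        (Finset.abs_sum_le_sum_abs _ _).trans ((Finset.sum_le_sum_of_subset_of_nonneg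
          (Finset.filter_subset _ _) fun _ _ _ => abs_nonneg _).trans hB)
      rw [div_div, ← sq_abs]
      gcongr
    · push Not at h
      have : d.numUntreated t = 0 := by
        rw [numUntreated, Finset.card_eq_zero, Finset.filter_eq_empty_iff]
        rintro p hp rfl
        exact (mem_untreatedObs.1 hp).2 (h p.1)
      rw [this, Nat.cast_zero, div_zero]
      positivity
  have s1 : d.I * ∑ i, (∑ p ∈ d.treatedObs with p.1 = i, |w p.1 p.2|) ^ 2
      ≤ (d.T * (C * B / c)) ^ 2 := by
    have := Finset.sum_le_sum fun i (_ : i ∈ (Finset.univ : Finset (Fin d.I))) => hR i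
    refine (mul_le_mul_of_nonneg_left this hI'.le).trans_eq ?_
    rw [Finset.sum_const, Finset.card_univ, Fintype.card_fin, nsmul_eq_mul]
    field_simp
  have s2 : d.I * ∑ i, (∑ p ∈ d.treatedObs with p.1 = i, w p.1 p.2) ^ 2
      ≤ (d.T * (C * B / c)) ^ 2 :=
    (mul_le_mul_of_nonneg_left (Finset.sum_le_sum fun i _ => hA i) hI'.le).trans s1
  have s3 : d.I * ∑ t with 0 < Fin.val (n := d.T) t,
      (∑ p ∈ d.treatedObs with p.2 = t, w p.1 p.2) ^ 2 / (d.numUntreated t : ℝ)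
      ≤ d.T * (B ^ 2 / c) := by
    have h1 : ∑ t with 0 < Fin.val (n := d.T) t,
        (∑ p ∈ d.treatedObs with p.2 = t, w p.1 p.2) ^ 2 / (d.numUntreated t : ℝ)
        ≤ d.T * (B ^ 2 / c / d.I) := by
      refine (Finset.sum_le_sum_of_subset_of_nonneg (Finset.filter_subset _ _)
        fun _ _ _ => by positivity).trans ?_
      exact (Finset.sum_le_card_nsmul _ _ _ fun t _ => hP t).trans_eq (by simp)
    refine (mul_le_mul_of_nonneg_left h1 hI'.le).trans_eq ?_
    field_simp
  refine (mul_le_mul_of_nonneg_left (herfindahl_le hid hfirst) hI'.le).trans ?_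
  have hT0 : (0 : ℝ) ≤ d.T := by positivity
  have s2' := mul_le_mul_of_nonneg_left s2 hT0
  have s3' := mul_le_mul_of_nonneg_left s3 (pow_nonneg hT0 2)
  nlinarith

end Complete

end Panel

/-! ### Asymptotics along a sequence of panels -/

theorem tendsto_herfindahl {d : ℕ → Panel} {w : ∀ n, Fin (d n).I → Fin (d n).T → ℝ}
    (hid : ∀ n, (d n).Identified (w n)) (h : ConsistencyConditions d w) :
    Tendsto (fun n => (d n).herfindahl (w n)) atTop (𝓝 0) := by
  have hlim := ((h.weights_herfindahl.const_mul 2).add (h.net_weights.const_mul 4)).add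
    (h.period_weights.const_mul 6)
  simp only [mul_zero, add_zero] at hlim
  exact squeeze_zero (fun n => Finset.sum_nonneg fun _ _ => sq_nonneg _)
    (fun n => Panel.herfindahl_le (hid n) (h.first_period n)) hlim

section Chebyshev

variable {S : Type*} [MeasurableSpace S] {P : Measure S} {X : S → ℝ}

theorem eLpNorm_two_eq_sqrt_variance (hX : MemLp X 2 P) (h0 : ∫ ω, X ω ∂P = 0) :
    eLpNorm X 2 P = ENNReal.ofReal (√(variance X P)) := by
  rw [hX.eLpNorm_eq_integral_rpow_norm (by norm_num) (by norm_num),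
    variance_of_integral_eq_zero hX.1.aemeasurable h0, Real.sqrt_eq_rpow]
  simp

theorem measure_le_abs_le [IsProbabilityMeasure P] (hX : MemLp X 2 P) (h0 : ∫ ω, X ω ∂P = 0) {V : ℝ}
    (hV : variance X P ≤ V) {δ : ℝ} (hδ : 0 < δ) :
    P {ω | δ ≤ |X ω|} ≤ ENNReal.ofReal (V / δ ^ 2) := by
  have := meas_ge_le_variance_div_sq hX hδ
  simp only [h0, sub_zero] at this
  exact this.trans (ENNReal.ofReal_le_ofReal (by gcongr))

end Chebyshev

/-- A weighted form of Jensen's inequality for the fourth power, by applying the Cauchy–Schwarz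
inequality twice. -/
theorem sum_mul_pow_four_le {κ : Type*} (s : Finset κ) (v x : κ → ℝ) :
    (∑ t ∈ s, v t * x t) ^ 4 ≤ (∑ t ∈ s, |v t|) ^ 3 * ∑ t ∈ s, |v t| * x t ^ 4 := by
  have h0 : 0 ≤ ∑ t ∈ s, |v t| := Finset.sum_nonneg fun _ _ => abs_nonneg _
  have h1 : (∑ t ∈ s, v t * x t) ^ 2 ≤ (∑ t ∈ s, |v t|) * ∑ t ∈ s, |v t| * x t ^ 2 :=
    Finset.sum_sq_le_sum_mul_sum_of_sq_le_mul s (fun _ _ => abs_nonneg _)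
      (fun _ _ => by positivity) fun t _ => by
        rw [← mul_assoc, abs_mul_abs_self]; exact le_of_eq (by ring)
  have h2 : (∑ t ∈ s, |v t| * x t ^ 2) ^ 2 ≤ (∑ t ∈ s, |v t|) * ∑ t ∈ s, |v t| * x t ^ 4 :=
    Finset.sum_sq_le_sum_mul_sum_of_sq_le_mul s (fun _ _ => abs_nonneg _)
      (fun _ _ => by positivity) fun t _ => le_of_eq (by ring)
  calc (∑ t ∈ s, v t * x t) ^ 4 = ((∑ t ∈ s, v t * x t) ^ 2) ^ 2 := by ring
    _ ≤ ((∑ t ∈ s, |v t|) * ∑ t ∈ s, |v t| * x t ^ 2) ^ 2 :=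
      pow_le_pow_left₀ (sq_nonneg _) h1 2
    _ = (∑ t ∈ s, |v t|) ^ 2 * (∑ t ∈ s, |v t| * x t ^ 2) ^ 2 := by ring
    _ ≤ (∑ t ∈ s, |v t|) ^ 2 * ((∑ t ∈ s, |v t|) * ∑ t ∈ s, |v t| * x t ^ 4) :=
      mul_le_mul_of_nonneg_left h2 (sq_nonneg _)
    _ = _ := by ring

theorem integral_sum_mul_pow_four_le {S : Type*} [MeasurableSpace S] {P : Measure S}
    [IsProbabilityMeasure P] {κ : Type*} [Fintype κ] (v : κ → ℝ) {ε : κ → S → ℝ} {K : ℝ}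
    (hε : ∀ t, MemLp (ε t) 4 P ∧ ∫ ω, ε t ω ^ 4 ∂P ≤ K) :
    ∫ ω, (∑ t, v t * ε t ω) ^ 4 ∂P ≤ K * (∑ t, |v t|) ^ 4 := by
  have hi : ∀ t, Integrable (fun ω => |v t| * ε t ω ^ 4) P := fun t =>
    (integrable_pow_of_memLp_four (hε t).1 4 le_rfl).const_mul _
  have hm : MemLp (fun ω => ∑ t, v t * ε t ω) 4 P :=
    memLp_finsetSum _ fun t _ => (hε t).1.const_mul _
  have h1 := integral_mono (integrable_pow_of_memLp_four hm 4 le_rfl)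
    ((integrable_finsetSum Finset.univ fun t _ => hi t).const_mul ((∑ t, |v t|) ^ 3))
    fun ω => sum_mul_pow_four_le Finset.univ v fun t => ε t ω
  refine h1.trans ?_
  rw [integral_const_mul, integral_finsetSum _ fun t _ => hi t]
  have h2 : ∑ t, ∫ ω, |v t| * ε t ω ^ 4 ∂P ≤ ∑ t, |v t| * K :=
    Finset.sum_le_sum fun t _ => by
      rw [integral_const_mul]
      exact mul_le_mul_of_nonneg_left (hε t).2 (abs_nonneg _)
  rw [← Finset.sum_mul] at h2
  refine (mul_le_mul_of_nonneg_left h2 ?_).trans_eq (by ring)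
  exact pow_nonneg (Finset.sum_nonneg fun _ _ => abs_nonneg _) 3

section Sequence

variable {S : ℕ → Type*} [∀ n, MeasurableSpace (S n)] {P : ∀ n, Measure (S n)}
  {d : ℕ → Panel} {w : ∀ n, Fin (d n).I → Fin (d n).T → ℝ}
  {Y Y0 : ∀ n, Fin (d n).I → Fin (d n).T → S n → ℝ}

theorem NormalityConditions.exists_abs_le (h : NormalityConditions P d w Y) :
    ∃ C : ℝ, 0 ≤ C ∧ ∀ n i j t, (d n).E i = (d n).E j → (d n).Treated i t →
      |w n i t| ≤ C * |w n j t| := by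
  obtain ⟨C, hC⟩ := h.comparable_weights
  refine ⟨|C|, abs_nonneg C, fun n i j t hE ht => ?_⟩
  by_cases hw : w n i t = 0
  · rw [hw, abs_zero]; positivity
  · obtain ⟨h1, h2⟩ := hC n i j t hE ht hw
    rw [div_le_iff₀ (abs_pos.2 h1)] at h2
    exact h2.trans (mul_le_mul_of_nonneg_right (le_abs_self C) (abs_nonneg _))

/-- The ratio in Lyapunov's condition vanishes: no unit dominates the Herfindahl index, as the units
of a cohort have comparable implied weights and cohorts grow. -/
theorem tendsto_lyapunov_ratio (hid : ∀ n, (d n).Identified (w n)) (h : ConsistencyConditions d w)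
    (hN : NormalityConditions P d w Y) :
    Tendsto (fun n => (∑ i, (∑ t, |(d n).impliedWeight (w n) i t|) ^ 4) /
      (d n).herfindahl (w n) ^ 2) atTop (𝓝 0) := by
  obtain ⟨C, hC, hw⟩ := hN.exists_abs_le
  rw [Metric.tendsto_nhds]
  intro e he
  obtain ⟨M, hM⟩ := exists_nat_gt ((1 + 2 * C) ^ 2 / e)
  have hM0 : (0 : ℝ) < M := lt_of_le_of_lt (by positivity) hM
  filter_upwards [hN.growing_cohorts M] with n hn
  obtain ⟨v, hv, -⟩ := Panel.exists_balanced (hid n) (h.first_period n)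
  set H := (d n).herfindahl (w n) with hHdef
  set s : Fin (d n).I → ℝ := fun i => ∑ t, |(d n).impliedWeight (w n) i t| with hs
  have hH : H = ∑ i, s i ^ 2 := Panel.herfindahl_of_complete (hN.complete n)
  have hH0 : 0 ≤ H := hH ▸ Finset.sum_nonneg fun _ _ => sq_nonneg _
  have hsi : ∀ i, s i ^ 2 ≤ (1 + 2 * C) ^ 2 / M * H := by
    intro i
    have h1 := Panel.cohortSize_mul_sq_le (hN.complete n) hv hC (hw n) i
    have h2 : M ≤ (d n).cohortSize ((d n).E i) := by
      refine (hn ((d n).E i)).resolve_left fun h0 => ?_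
      rw [Panel.cohortSize, Finset.card_eq_zero, Finset.filter_eq_empty_iff] at h0
      exact h0 (Finset.mem_univ i) rfl
    rw [div_mul_eq_mul_div, le_div_iff₀ hM0, mul_comm]
    exact (mul_le_mul_of_nonneg_right (by exact_mod_cast h2) (sq_nonneg _)).trans h1
  have hsum : ∑ i, s i ^ 4 ≤ (1 + 2 * C) ^ 2 / M * H ^ 2 := by
    calc ∑ i, s i ^ 4 ≤ ∑ i, (1 + 2 * C) ^ 2 / M * H * s i ^ 2 :=
          Finset.sum_le_sum fun i _ => by
            have := mul_le_mul_of_nonneg_right (hsi i) (sq_nonneg (s i))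
            calc s i ^ 4 = s i ^ 2 * s i ^ 2 := by ring
              _ ≤ _ := this
      _ = _ := by rw [← Finset.mul_sum, ← hH]; ring
  have h4 : 0 ≤ ∑ i, s i ^ 4 := Finset.sum_nonneg fun _ _ => by positivity
  rw [Real.dist_eq, sub_zero, abs_of_nonneg (by positivity)]
  refine lt_of_le_of_lt (div_le_of_le_mul₀ (by positivity) (by positivity) hsum) ?_
  rwa [div_lt_iff₀ hM0, ← div_lt_iff₀' he]

variable [∀ n, IsProbabilityMeasure (P n)]

theorem tendsto_eLpNorm_estimation_error (hid : ∀ n, (d n).Identified (w n))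
    (hpt : ∀ n, (d n).ParallelTrends (P n) (Y0 n))
    (hna : ∀ n, (d n).NoAnticipation (P n) (Y n) (Y0 n)) {σ2 : ℝ}
    (hcl : ∀ n, (d n).ClusteredErrors (P n) (Y n) σ2) (h : ConsistencyConditions d w) :
    Tendsto (fun n => eLpNorm (fun ω => (d n).tauHat (w n) (Y n) ω -
      (d n).target (P n) (w n) (Y n) (Y0 n)) 2 (P n)) atTop (𝓝 0) := by
  have hlim : Tendsto (fun n => ENNReal.ofReal (√(σ2 * (d n).herfindahl (w n)))) atTop (𝓝 0) := by
    have := ENNReal.tendsto_ofReal ((tendsto_herfindahl hid h).const_mul σ2).sqrt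
    simpa using this
  refine tendsto_of_tendsto_of_tendsto_of_le_of_le tendsto_const_nhds hlim (fun _ => zero_le)
    fun n => ?_
  obtain ⟨v, hv, -⟩ := Panel.exists_balanced (hid n) (h.first_period n)
  obtain ⟨hm, h0, -, hle⟩ := Panel.estimation_error hv (hpt n) (hna n) (hcl n)
  simp only [eLpNorm_two_eq_sqrt_variance hm h0]
  exact ENNReal.ofReal_le_ofReal (Real.sqrt_le_sqrt hle)

theorem tendsto_measure_estimation_error (hid : ∀ n, (d n).Identified (w n))
    (hpt : ∀ n, (d n).ParallelTrends (P n) (Y0 n))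
    (hna : ∀ n, (d n).NoAnticipation (P n) (Y n) (Y0 n)) {σ2 : ℝ}
    (hcl : ∀ n, (d n).ClusteredErrors (P n) (Y n) σ2) (h : ConsistencyConditions d w)
    {δ : ℝ} (hδ : 0 < δ) :
    Tendsto (fun n => P n {ω | δ ≤ |(d n).tauHat (w n) (Y n) ω -
      (d n).target (P n) (w n) (Y n) (Y0 n)|}) atTop (𝓝 0) := by
  have hlim : Tendsto (fun n => ENNReal.ofReal (σ2 * (d n).herfindahl (w n) / δ ^ 2))
      atTop (𝓝 0) := by
    have := ENNReal.tendsto_ofReal (((tendsto_herfindahl hid h).const_mul σ2).div_const (δ ^ 2))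
    simpa using this
  refine tendsto_of_tendsto_of_tendsto_of_le_of_le tendsto_const_nhds hlim (fun _ => zero_le)
    fun n => ?_
  obtain ⟨v, hv, -⟩ := Panel.exists_balanced (hid n) (h.first_period n)
  obtain ⟨hm, h0, -, hle⟩ := Panel.estimation_error hv (hpt n) (hna n) (hcl n)
  exact measure_le_abs_le hm h0 hle hδ

theorem root_consistency (hid : ∀ n, (d n).Identified (w n))
    (hpt : ∀ n, (d n).ParallelTrends (P n) (Y0 n))
    (hna : ∀ n, (d n).NoAnticipation (P n) (Y n) (Y0 n)) {σ2 : ℝ}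
    (hcl : ∀ n, (d n).ClusteredErrors (P n) (Y n) σ2) (h : ConsistencyConditions d w)
    (hN : NormalityConditions P d w Y) (hR : RateConditions d w) {η : ENNReal} (hη : 0 < η) :
    ∃ K : ℝ, ∀ᶠ n in atTop, P n {ω | K < √((d n).I : ℝ) * |(d n).tauHat (w n) (Y n) ω -
      (d n).target (P n) (w n) (Y n) (Y0 n)|} ≤ η := by
  rcases eq_or_ne η ⊤ with rfl | hη'
  · exact ⟨0, Eventually.of_forall fun _ => le_top⟩
  obtain ⟨C, hC, hw⟩ := hN.exists_abs_le
  obtain ⟨T, hT⟩ := hN.fixed_periods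
  obtain ⟨c, hc, hshare⟩ := hR.cohort_shares
  obtain ⟨B, hB⟩ := hR.bounded_weights
  set M : ℝ := (2 + 4 * T) * (T * (C * B / c)) ^ 2 + 6 * T ^ 3 * (B ^ 2 / c) with hM
  set V : ℝ := |σ2| * M with hV
  have hM0 : 0 ≤ M := by positivity
  have hη0 : 0 < η.toReal := ENNReal.toReal_pos hη.ne' hη'
  refine ⟨√(V / η.toReal) + 1, ?_⟩
  filter_upwards [hshare, hB] with n hshare hB
  obtain ⟨v, hv, -⟩ := Panel.exists_balanced (hid n) (h.first_period n)
  obtain ⟨hm, h0, -, hle⟩ := Panel.estimation_error hv (hpt n) (hna n) (hcl n)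
  set X : S n → ℝ := fun ω => (d n).tauHat (w n) (Y n) ω -
    (d n).target (P n) (w n) (Y n) (Y0 n) with hX
  have hIH : (d n).I * (d n).herfindahl (w n) ≤ M := by
    rw [hM, ← hT n]
    exact Panel.units_mul_herfindahl_le (hN.complete n) (hid n) (h.first_period n) hC
      (hw n) hc hshare hB
  have hH0 : 0 ≤ (d n).herfindahl (w n) := Finset.sum_nonneg fun _ _ => sq_nonneg _
  have hvar : variance (fun ω => √((d n).I : ℝ) * X ω) (P n) ≤ V := by
    rw [variance_const_mul, Real.sq_sqrt (by positivity)]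
    calc ((d n).I : ℝ) * variance X (P n) ≤ (d n).I * (|σ2| * (d n).herfindahl (w n)) := by
          refine mul_le_mul_of_nonneg_left (hle.trans ?_) (by positivity)
          exact mul_le_mul_of_nonneg_right (le_abs_self _) hH0
      _ = |σ2| * ((d n).I * (d n).herfindahl (w n)) := by ring
      _ ≤ V := mul_le_mul_of_nonneg_left hIH (abs_nonneg _)
  have hK : 0 < √(V / η.toReal) + 1 := by positivity
  have hcheb := measure_le_abs_le (hm.const_mul (√((d n).I : ℝ)))
    (by rw [integral_const_mul, h0, mul_zero]) hvar hK
  refine (measure_mono fun ω hω => ?_).trans (hcheb.trans ?_)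
  · rw [Set.mem_ofPred_eq] at hω ⊢
    rw [abs_mul, abs_of_nonneg (Real.sqrt_nonneg _)]
    exact hω.le
  · refine ENNReal.ofReal_le_of_le_toReal ?_
    rw [div_le_iff₀ (by positivity)]
    have h1 : V / η.toReal ≤ (√(V / η.toReal) + 1) ^ 2 := by
      have h2 := Real.sq_sqrt (show 0 ≤ V / η.toReal by positivity)
      nlinarith [Real.sqrt_nonneg (V / η.toReal)]
    rwa [div_le_iff₀ hη0, mul_comm] at h1

theorem asymptotic_normality (hid : ∀ n, (d n).Identified (w n))
    (hpt : ∀ n, (d n).ParallelTrends (P n) (Y0 n))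
    (hna : ∀ n, (d n).NoAnticipation (P n) (Y n) (Y0 n)) {σ2 : ℝ}
    (hcl : ∀ n, (d n).ClusteredErrors (P n) (Y n) σ2) (h : ConsistencyConditions d w)
    (hN : NormalityConditions P d w Y) (hind : ∀ n, (d n).IndependentUnits (P n) (Y n))
    (hvar : NonvanishingVariance P d w Y) :
    TendstoInDistribution (fun n ω =>
      (√(ProbabilityTheory.variance ((d n).tauHat (w n) (Y n)) (P n)))⁻¹ *
        ((d n).tauHat (w n) (Y n) ω - (d n).target (P n) (w n) (Y n) (Y0 n)))
      atTop id P (gaussianReal 0 1) := by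
  obtain ⟨K, hK⟩ := hN.fourth_moments
  obtain ⟨c, hc, hcvar⟩ := hvar
  choose v hv _ using fun n => Panel.exists_balanced (hid n) (h.first_period n)
  set σ : ℕ → ℝ := fun n => √(variance ((d n).tauHat (w n) (Y n)) (P n)) with hσ
  -- the standardized contribution of unit `i` to the estimation error
  set X : ∀ n, Fin (d n).I → S n → ℝ := fun n i ω =>
    ∑ t, ((σ n)⁻¹ * (d n).impliedWeight (w n) i t) * (d n).err (P n) (Y n) i t ω with hX
  have hX4 : ∀ n i, MemLp (X n i) 4 (P n) := fun n i =>
    memLp_finsetSum _ fun t _ => (hK n i t).1.const_mul _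
  have hmem : ∀ n (p : Fin (d n).I × Fin (d n).T), p ∈ (d n).obs := fun n p => by
    simp [hN.complete n]
  have hYi : ∀ n i t, Integrable (Y n i t) (P n) := fun n i t =>
    ((hcl n).1 (i, t) (hmem n _)).1.integrable (by norm_num)
  have hX0 : ∀ n i, ∫ ω, X n i ω ∂P n = 0 := fun n i => by
    rw [integral_finsetSum _ fun t _ => ((hK n i t).1.integrable (by norm_num)).const_mul _]
    refine Finset.sum_eq_zero fun t _ => ?_
    rw [integral_const_mul, Panel.integral_err (hYi n i t), mul_zero]
  have hXind : ∀ n, iIndepFun (X n) (P n) := fun n =>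
    (hind n).comp (fun i x => ∑ t, ((σ n)⁻¹ * (d n).impliedWeight (w n) i t) * x t)
      fun i => by fun_prop
  have hXsum : ∀ n ω, (σ n)⁻¹ * ((d n).tauHat (w n) (Y n) ω -
      (d n).target (P n) (w n) (Y n) (Y0 n)) = ∑ i, X n i ω := fun n ω => by
    rw [Panel.tauHat_sub_target (hv n) (hpt n) (hna n) (fun p _ => hYi n p.1 p.2) ω,
      hN.complete n, Fintype.sum_prod_type, Finset.mul_sum]
    refine Finset.sum_congr rfl fun i _ => ?_
    rw [Finset.mul_sum]
    exact Finset.sum_congr rfl fun t _ => by ring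
  -- the variance is of no smaller order than the Herfindahl index, which is therefore positive
  have hpos : ∀ᶠ n in atTop, 0 < (d n).herfindahl (w n) ∧
      c * (d n).herfindahl (w n) ≤ σ n ^ 2 := by
    filter_upwards [hcvar] with n hn
    have hH0 : 0 ≤ (d n).herfindahl (w n) := Finset.sum_nonneg fun _ _ => sq_nonneg _
    rcases hH0.eq_or_lt with h0 | h0
    · rw [← h0, inv_zero, zero_mul] at hn
      exact absurd hn (not_le.2 hc)
    · refine ⟨h0, ?_⟩
      rw [hσ, Real.sq_sqrt (variance_nonneg _ _)]
      rwa [inv_mul_eq_div, le_div_iff₀ h0] at hn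
  change TendstoInDistribution (fun n ω => (σ n)⁻¹ * ((d n).tauHat (w n) (Y n) ω -
    (d n).target (P n) (w n) (Y n) (Y0 n))) atTop id P (gaussianReal 0 1)
  simp only [hXsum]
  refine tendstoInDistribution_sum_of_fourth_moments hXind hX4 hX0 ?_ ?_
  · filter_upwards [hpos] with n ⟨hH, hσH⟩
    have hσ0 : 0 < σ n ^ 2 := lt_of_lt_of_le (mul_pos hc hH) hσH
    have hX2 : ∀ i, MemLp (X n i) 2 (P n) := fun i => (hX4 n i).mono_exponent (by norm_num)
    have h1 : variance (∑ i, X n i) (P n) = ∑ i, variance (X n i) (P n) :=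
      IndepFun.variance_sum (fun i _ => hX2 i) fun i _ j _ hij => (hXind n).indepFun hij
    have h2 : ∑ i, X n i = fun ω => (σ n)⁻¹ * ((d n).tauHat (w n) (Y n) ω -
        (d n).target (P n) (w n) (Y n) (Y0 n)) := by
      ext ω
      rw [hXsum, Finset.sum_apply]
    obtain ⟨-, -, h3, -⟩ := Panel.estimation_error (hv n) (hpt n) (hna n) (hcl n)
    rw [h2, variance_const_mul, h3] at h1
    have h4 : variance ((d n).tauHat (w n) (Y n)) (P n) = σ n ^ 2 :=
      (Real.sq_sqrt (variance_nonneg _ _)).symm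
    rw [h4, inv_pow, inv_mul_cancel₀ hσ0.ne'] at h1
    rw [h1]
    exact Finset.sum_congr rfl fun i _ =>
      (variance_of_integral_eq_zero (hX4 n i).1.aemeasurable (hX0 n i)).symm
  · have hlim := (tendsto_lyapunov_ratio hid h hN).const_mul (|K| / c ^ 2)
    rw [mul_zero] at hlim
    refine squeeze_zero' (Eventually.of_forall fun n => Finset.sum_nonneg fun i _ =>
      integral_nonneg fun _ => by positivity) ?_ hlim
    filter_upwards [hpos] with n ⟨hH, hσH⟩
    have hσ0 : 0 < σ n ^ 2 := lt_of_lt_of_le (mul_pos hc hH) hσH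
    have h1 : ∀ i, ∫ ω, X n i ω ^ 4 ∂P n
        ≤ |K| * ((σ n ^ 2) ^ 2)⁻¹ * (∑ t, |(d n).impliedWeight (w n) i t|) ^ 4 := by
      intro i
      refine (integral_sum_mul_pow_four_le _ fun t =>
        ⟨(hK n i t).1, (hK n i t).2.trans (le_abs_self K)⟩).trans_eq ?_
      simp only [abs_mul, ← Finset.mul_sum, mul_pow, abs_inv, inv_pow]
      rw [← pow_mul, mul_assoc]
      congr 3
      rw [show (4 : ℕ) = 2 * 2 by norm_num, pow_mul, pow_mul, sq_abs]
    refine (Finset.sum_le_sum fun i _ => h1 i).trans ?_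
    rw [← Finset.mul_sum, div_mul_div_comm, ← mul_pow, ← div_eq_mul_inv, div_mul_eq_mul_div]
    have h5 : 0 ≤ ∑ i, (∑ t, |(d n).impliedWeight (w n) i t|) ^ 4 :=
      Finset.sum_nonneg fun _ _ => by positivity
    have : 0 < c * (d n).herfindahl (w n) := mul_pos hc hH
    gcongr

end Sequence

theorem mainTheorem5 {S : ℕ → Type*} [∀ n, MeasurableSpace (S n)]
    (P : ∀ n, Measure (S n)) [∀ n, IsProbabilityMeasure (P n)]
    (d : ℕ → Panel) (w : ∀ n, Fin (d n).I → Fin (d n).T → ℝ)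
    (Y Y0 : ∀ n, Fin (d n).I → Fin (d n).T → S n → ℝ)
    (identified : ∀ n, (d n).Identified (w n))
    (parallel_trends : ∀ n, (d n).ParallelTrends (P n) (Y0 n))
    (no_anticipation : ∀ n, (d n).NoAnticipation (P n) (Y n) (Y0 n))
    (clustered : ∃ σ2 : ℝ, ∀ n, (d n).ClusteredErrors (P n) (Y n) σ2)
    (consistency : ConsistencyConditions d w) :
    -- consistency, in mean square and in probability
    (Tendsto (fun n => eLpNorm (fun ω => (d n).tauHat (w n) (Y n) ω -
        (d n).target (P n) (w n) (Y n) (Y0 n)) 2 (P n)) atTop (𝓝 0) ∧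
      ∀ δ : ℝ, 0 < δ → Tendsto (fun n => P n {ω | δ ≤ |(d n).tauHat (w n) (Y n) ω -
        (d n).target (P n) (w n) (Y n) (Y0 n)|}) atTop (𝓝 0)) ∧
    (NormalityConditions P d w Y →
      -- root-`I` consistency
      (RateConditions d w → ∀ η : ENNReal, 0 < η → ∃ K : ℝ, ∀ᶠ n in atTop,
        P n {ω | K < √((d n).I : ℝ) * |(d n).tauHat (w n) (Y n) ω -
          (d n).target (P n) (w n) (Y n) (Y0 n)|} ≤ η) ∧
      -- asymptotic Normality
      ((∀ n, (d n).IndependentUnits (P n) (Y n)) → NonvanishingVariance P d w Y →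
        TendstoInDistribution (fun n ω =>
          (√(ProbabilityTheory.variance ((d n).tauHat (w n) (Y n)) (P n)))⁻¹ *
            ((d n).tauHat (w n) (Y n) ω - (d n).target (P n) (w n) (Y n) (Y0 n)))
          atTop id P (gaussianReal 0 1))) := by
  obtain ⟨σ2, hcl⟩ := clustered
  refine ⟨⟨tendsto_eLpNorm_estimation_error identified parallel_trends no_anticipation hcl
      consistency, fun δ hδ => tendsto_measure_estimation_error identified parallel_trends
      no_anticipation hcl consistency hδ⟩, fun hN => ⟨fun hR η hη => ?_, fun hind hvar => ?_⟩⟩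
  · exact root_consistency identified parallel_trends no_anticipation hcl consistency hN hR hη
  · exact asymptotic_normality identified parallel_trends no_anticipation hcl consistency hN hind
      hvar
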